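/- Let $n\ge 0$, $m\ge 1$ be integers, $N=2n+1$, $M=2m+1$ with $M\ge N$, and let $T>1$ be real such that $L=2Tm$ is an integer. Let $A\in\mathbb{C}^{M\times N}$ be the discrete Fourier extension matrix $$A_{l,k}=\frac{1}{\sqrt{2Tm}}\,e^{\mathrm{i}\pi kl/(Tm)},\qquad -m\le l\le m,\ -n\le k\le n,$$ with singular values $\sigma_0\ge\sigma_1\ge\dots\ge\sigma_{N-1}$, counted with multiplicity. Let $T_{N,M}$ be the real symmetric tridiagonal $N\times N$ matrix with diagonal entries $c_0,\dots,c_{N-1}$ and off-diagonal entries $b_1,\dots,b_{N-1}$, where $$c_k=-\cos\frac{\pi(2k+1-N)}{L}\,\cos\frac{\pi M}{L},\qquad b_k=\sin\frac{\pi k}{L}\,\sin\frac{\pi(N-k)}{L},$$ and let $\theta_0\ge\theta_1\ge\dots\ge\theta_{N-1}$ be its eigenvalues. Call a map $\mathcal{G}':\{0,\dots,N-1\}\to\{0,\dots,N-1\}$ an index map if there is an orthonormal basis $\varphi_0,\dots,\varphi_{N-1}$ of $\mathbb{C}^N$ with $A^HA\varphi_i=\sigma_i^2\varphi_i$ and $T_{N,M}\varphi_i=\theta_{\mathcal{G}'(i)}\varphi_i$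 for all $i$. Then: 1. $A^HA$ is symmetric and commutes with $T_{N,M}$, and $\theta_0>\theta_1>\dots>\theta_{N-1}$. 2. For $i_1<i_2$ one has $\sigma_{i_1}=\sigma_{i_2}$ if and only if $i_2<M+N-L$; thus the singular values are pairwise distinct whenever $L\ge M+N-1$. 3. The identity is an index map. Every index map $\mathcal{G}'$ is monotone: $i_1>i_2\Leftrightarrow\mathcal{G}'(i_1)>\mathcal{G}'(i_2)$ for all $i_1,i_2$ with $\sigma_{i_1}\ne\sigma_{i_2}$. 4. If $L\ge M+N-1$, then the index map is unique, $i_1>i_2\Leftrightarrow\mathcal{G}'(i_1)>\mathcal{G}'(i_2)$ holds for all $i_1,i_2$, and hence $\mathcal{G}'(i)=i$ for all $i$. -/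

import Mathlib

noncomputable section

/-- The matrix `A` of the discrete Fourier extension problem, with `N = 2n+1` basis functions
`exp(iπkx/T) / √(2T)`, `k = -n, …, n`, sampled in the `M = 2m+1` points `x_l = l/m`,
`l = -m, …, m`, and scaled by `1/√m`. Row `r` stands for `l = r - m`, column `s` for `k = s - n`. -/
def feMatrix (n m : ℕ) (T : ℝ) : Matrix (Fin (2 * m + 1)) (Fin (2 * n + 1)) ℂ :=
  Matrix.of fun r s =>
    ((1 / Real.sqrt (2 * T * m) : ℝ) : ℂ) *
      Complex.exp (Complex.I *
        ((Real.pi * ((s : ℝ) - n) * ((r : ℝ) - m) / (T * m) : ℝ) : ℂ))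

/-- The diagonal entries `c_k`, `k = 0, …, N-1`, of the tridiagonal matrix `T_{N,M}`. -/
def jacobiDiag (N M : ℕ) (L : ℝ) (k : ℕ) : ℝ :=
  -(Real.cos (Real.pi * (2 * (k : ℝ) + 1 - N) / L) * Real.cos (Real.pi * M / L))

/-- The off-diagonal entries `b_k`, `k = 1, …, N-1`, of the tridiagonal matrix `T_{N,M}`. -/
def jacobiOff (N : ℕ) (L : ℝ) (k : ℕ) : ℝ :=
  Real.sin (Real.pi * k / L) * Real.sin (Real.pi * ((N : ℝ) - k) / L)

/-- The `N × N` tridiagonal (Jacobi) matrix `T_{N,M}` for period `L`: the diagonal is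
`c_0, …, c_{N-1}`, the entry at `(k-1, k)` and `(k, k-1)` is `b_k`. -/
def jacobiMatrix (N M : ℕ) (L : ℝ) : Matrix (Fin N) (Fin N) ℝ :=
  Matrix.of fun i j =>
    if (i : ℕ) = j then jacobiDiag N M L i
    else if (i : ℕ) + 1 = j then jacobiOff N L j
    else if (j : ℕ) + 1 = i then jacobiOff N L i
    else 0

theorem jacobiMatrix_isHermitian (N M : ℕ) (L : ℝ) : (jacobiMatrix N M L).IsHermitian := by
  ext i j
  simp only [jacobiMatrix, Matrix.conjTranspose_apply, Matrix.of_apply, star_trivial]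
  by_cases h : (i : ℕ) = j
  · simp [h]
  · have h' : (j : ℕ) ≠ i := fun e => h e.symm
    by_cases h1 : (i : ℕ) + 1 = j
    · have h2 : (j : ℕ) + 1 ≠ i := by omega
      simp [h, h', h1, h2]
    · simp [h, h', h1]

/-- `θ_0 ≥ θ_1 ≥ … ≥ θ_{N-1}`: the eigenvalues of `T_{N,M}`, counted with multiplicity. -/
def jacobiEigenvalue (N M : ℕ) (L : ℝ) (j : Fin N) : ℝ :=
  (jacobiMatrix_isHermitian N M L).eigenvalues₀ (Fin.cast (Fintype.card_fin N).symm j)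

/-- `σ_0 ≥ σ_1 ≥ … ≥ σ_{N-1}`: the singular values of `A`, counted with multiplicity. -/
def feSingularValue (n m : ℕ) (T : ℝ) (i : Fin (2 * n + 1)) : ℝ :=
  (Matrix.toEuclideanLin (feMatrix n m T)).singularValues i

/-- The matrix `T_{N,M}` that belongs to `A`, as a complex matrix:
`N = 2n+1`, `M = 2m+1`, `L = 2Tm`. -/
def feJacobi (n m : ℕ) (T : ℝ) : Matrix (Fin (2 * n + 1)) (Fin (2 * n + 1)) ℂ :=
  (jacobiMatrix (2 * n + 1) (2 * m + 1) (2 * T * m)).map (fun x : ℝ => (x : ℂ))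

/-- The eigenvalues `θ_0 ≥ … ≥ θ_{N-1}` of the matrix `T_{N,M}` that belongs to `A`. -/
def feTheta (n m : ℕ) (T : ℝ) (j : Fin (2 * n + 1)) : ℝ :=
  jacobiEigenvalue (2 * n + 1) (2 * m + 1) (2 * T * m) j

/-- `g` is an index map `i ↦ j` from the singular values of `A` to the eigenvalues of `T_{N,M}`:
there is an orthonormal basis `φ_0, …, φ_{N-1}` (discrete prolate sequences) such that
`φ_i` is a right singular vector of `A` for `σ_i` and an eigenvector of `T_{N,M}`
for `θ_{g i}`. -/
def IsIndexMap (n m : ℕ) (T : ℝ) (g : Fin (2 * n + 1) → Fin (2 * n + 1)) : Prop :=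
  ∃ φ : OrthonormalBasis (Fin (2 * n + 1)) ℂ (EuclideanSpace ℂ (Fin (2 * n + 1))),
    ∀ i,
      Matrix.toEuclideanLin ((feMatrix n m T).conjTranspose * feMatrix n m T) (φ i)
          = ((feSingularValue n m T i ^ 2 : ℝ) : ℂ) • φ i ∧
      Matrix.toEuclideanLin (feJacobi n m T) (φ i)
          = ((feTheta n m T (g i) : ℝ) : ℂ) • φ i

end

/-! With `α = π/L`, the Gram matrix `AᴴA` is `1/L` times the Dirichlet kernel matrix with entries
`sin(αMd)/sin(αd)`, `d = i - j`. It commutes with the tridiagonal matrix `T_{N,M}`, whose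
off-diagonal entries do not vanish, so `T_{N,M}` has simple spectrum and its eigenvectors also
diagonalise `AᴴA`. What remains is the order of the kernel eigenvalues ("energies") along the
eigenvectors sorted by decreasing `θ`.

The core is a statement about a real parameter `α > 0` with `(M + N - 2)α < π` and `(N - 1)α < π`:
the energies decrease strictly as long as the smaller index is below `M`, and they vanish from index
`M` on (`IsFrame.energy_lt`, `IsFrame.energy_eq_zero`). It is proved by deformation in `α`.

Small `α` (`eventually_energy_lt`): after subtracting `-1` and dividing by `α²`, the tridiagonal
matrix has a limit that is triangular on falling factorials. Hence the `i`-th limiting eigenvector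
has vanishing moments of order below `i` and a nonzero one of order `i`. Its energy is therefore at
least of order `α^(2i)`, while vectors with `i + 1` vanishing moments have energy of order
`α^(2i+2)`; a dimension count gives the order.

No crossing (`kernel_eigenvalue_ne`): eigenvectors for distinct `θ` cannot share a nonzero energy.
Convolution with the kernel extends an eigenvector to all integers, still solving the three-term
recurrence. Pairing two such extensions with shifts by 1 and 2 forces both to vanish just outside
the support, hence at `M - 1` consecutive points. A combination vanishing at one more point is a sum
of `M` exponentials with `M` consecutive zeros, so it is zero. Compactness of the set of eigenbases
and connectedness of the parameter interval then carry the order from small `α` to the given one.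

The bound `(M + N - 2)α < π` can fail for the given `M`, but `N ≤ M` ensures it for the
complementary count `M' = L - M`. Conjugation by alternating signs turns the kernel matrix into `L`
minus that of `M'`, and `T_{N,M}` into minus that of `M'`. Both orders reverse, so `σ_i` goes with
`θ_i`, and the zero energies become the repeated singular value 1. -/

namespace PeriodicProlate

/-! ### Dirichlet kernel and the commuting difference operator -/

open Finset

/-- The angular frequencies `α(2l+1-M)`, `l = 0, …, M-1`, symmetric about zero. -/
noncomputable def freq (M : ℕ) (α : ℝ) (l : ℕ) : ℝ := α * (2 * l + 1 - M)

/-- The Dirichlet kernel `∑ exp(i α(2l+1-M) d)`. -/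
noncomputable def dirichletKer (M : ℕ) (α : ℝ) (d : ℤ) : ℂ :=
  ∑ l ∈ range M, Complex.exp (((freq M α l * d : ℝ) : ℂ) * Complex.I)

/-- Diagonal coefficients of the commuting difference operator. -/
noncomputable def diagCoeff (N M : ℕ) (α : ℝ) (x : ℤ) : ℝ :=
  -(Real.cos (α * (2 * x + 1 - N)) * Real.cos (α * M))

/-- Off-diagonal coefficients of the commuting difference operator. -/
noncomputable def offCoeff (N : ℕ) (α : ℝ) (x : ℤ) : ℝ :=
  Real.sin (α * x) * Real.sin (α * (N - x))

/-- The three-term difference operator with coefficients `c`, `b`. -/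
noncomputable def triOp (c b : ℤ → ℝ) (v : ℤ → ℂ) (x : ℤ) : ℂ :=
  b x * v (x - 1) + c x * v x + b (x + 1) * v (x + 1)

/-- Convolution of the first `N` entries of `v` with the Dirichlet kernel. -/
noncomputable def kerConv (N M : ℕ) (α : ℝ) (v : ℤ → ℂ) (x : ℤ) : ℂ :=
  ∑ j ∈ range N, dirichletKer M α (x - j) * v j

/-- Multiplication by the sine makes the geometric sum telescope. The product form avoids dividing
by a sine that may vanish. -/
theorem sin_mul_dirichletKer (M : ℕ) (α : ℝ) (d : ℤ) :
    (Real.sin (α * d) : ℂ) * dirichletKer M α d = (Real.sin (α * M * d) : ℂ) := by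
  have key : ∀ l : ℕ, (Real.sin (α * d) : ℂ) *
      Complex.exp (((freq M α l * d : ℝ) : ℂ) * Complex.I) =
      (Complex.exp (((α * (2 * (l + 1 : ℕ) - M) * d : ℝ) : ℂ) * Complex.I) -
        Complex.exp (((α * (2 * l - M) * d : ℝ) : ℂ) * Complex.I)) / (2 * Complex.I) := by
    intro l
    have h1 : (((α * (2 * (l + 1 : ℕ) - M) * d : ℝ) : ℂ) * Complex.I) =
        ((freq M α l * d : ℝ) : ℂ) * Complex.I + ((α * d : ℝ) : ℂ) * Complex.I := by
      simp only [freq]; push_cast; ring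
    have h2 : (((α * (2 * l - M) * d : ℝ) : ℂ) * Complex.I) =
        ((freq M α l * d : ℝ) : ℂ) * Complex.I + (-((α * d : ℝ) : ℂ)) * Complex.I := by
      simp only [freq]; push_cast; ring
    rw [h1, h2, Complex.exp_add, Complex.exp_add, Complex.ofReal_sin, Complex.sin]
    field_simp
    rw [Complex.I_sq]
    ring
  rw [dirichletKer, mul_sum, sum_congr rfl fun l _ => key l, ← sum_div,
    sum_range_sub (fun l : ℕ => Complex.exp (((α * (2 * (l : ℕ) - M) * d : ℝ) : ℂ) * Complex.I)),
    Complex.ofReal_sin, Complex.sin]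
  have h1 : (((α * (2 * M - M) * d : ℝ) : ℂ) * Complex.I) =
      ((α * M * d : ℝ) : ℂ) * Complex.I := by push_cast; ring
  have h2 : (((α * (2 * (0 : ℕ) - M) * d : ℝ) : ℂ) * Complex.I) =
      -((α * M * d : ℝ) : ℂ) * Complex.I := by push_cast; ring
  rw [h1, h2]
  field_simp
  rw [Complex.I_sq]
  ring

theorem dirichletKer_neg (M : ℕ) (α : ℝ) (d : ℤ) :
    dirichletKer M α (-d) = dirichletKer M α d := by
  rw [dirichletKer, ← sum_range_reflect, dirichletKer]
  refine sum_congr rfl fun l hl => ?_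
  have hl' := mem_range.1 hl
  congr 3
  have : ((M - 1 - l : ℕ) : ℝ) = M - 1 - l := by
    rw [Nat.cast_sub (by omega), Nat.cast_sub (by omega)]; simp
  rw [freq, freq, this]; push_cast; ring

/-- The three coefficient differences share the factor `S = sin(α(x + y + 1 - N))`, and each
remaining sine is the one that turns its kernel value into `sin(αM·)`. The identity reduces to the
addition formula `t`. -/
theorem dirichletKer_comm (N M : ℕ) (α : ℝ) (x y : ℤ) :
    (offCoeff N α x : ℂ) * dirichletKer M α (x - 1 - y) +
      diagCoeff N M α x * dirichletKer M α (x - y) +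
      offCoeff N α (x + 1) * dirichletKer M α (x + 1 - y) =
    (offCoeff N α y : ℂ) * dirichletKer M α (x - (y - 1)) +
      diagCoeff N M α y * dirichletKer M α (x - y) +
      offCoeff N α (y + 1) * dirichletKer M α (x - (y + 1)) := by
  have e1 : x - 1 - y = (x - y) - 1 := by ring
  have e2 : x + 1 - y = (x - y) + 1 := by ring
  have e3 : x - (y - 1) = (x - y) + 1 := by ring
  have e4 : x - (y + 1) = (x - y) - 1 := by ring
  rw [e1, e2, e3, e4]
  have s1 := sin_mul_dirichletKer M α (x - y - 1)
  have s2 := sin_mul_dirichletKer M α (x - y)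
  have s3 := sin_mul_dirichletKer M α (x - y + 1)
  set S : ℝ := Real.sin (α * (x + y + 1 - N)) with hS
  have d1 : offCoeff N α x - offCoeff N α (y + 1) = -(S * Real.sin (α * ((x - y - 1 : ℤ) : ℝ))) := by
    simp only [offCoeff, hS]
    have p (a b : ℝ) : Real.sin a * Real.sin b = (Real.cos (a - b) - Real.cos (a + b)) / 2 := by
      rw [Real.cos_sub, Real.cos_add]; ring
    rw [p, p, p]; push_cast; ring_nf
  have d2 : diagCoeff N M α x - diagCoeff N M α y =
      2 * Real.cos (α * M) * (S * Real.sin (α * ((x - y : ℤ) : ℝ))) := by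
    simp only [diagCoeff, hS]
    have p (a b : ℝ) : Real.sin a * Real.sin b = (Real.cos (a - b) - Real.cos (a + b)) / 2 := by
      rw [Real.cos_sub, Real.cos_add]; ring
    rw [p]; push_cast; ring_nf
  have d3 : offCoeff N α (x + 1) - offCoeff N α y =
      -(S * Real.sin (α * ((x - y + 1 : ℤ) : ℝ))) := by
    simp only [offCoeff, hS]
    have p (a b : ℝ) : Real.sin a * Real.sin b = (Real.cos (a - b) - Real.cos (a + b)) / 2 := by
      rw [Real.cos_sub, Real.cos_add]; ring
    rw [p, p, p]; push_cast; ring_nf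
  have t : Real.sin (α * M * ((x - y - 1 : ℤ) : ℝ)) + Real.sin (α * M * ((x - y + 1 : ℤ) : ℝ)) =
      2 * Real.cos (α * M) * Real.sin (α * M * ((x - y : ℤ) : ℝ)) := by
    have h1 : α * M * ((x - y - 1 : ℤ) : ℝ) = α * M * ((x - y : ℤ) : ℝ) - α * M := by
      push_cast; ring
    have h2 : α * M * ((x - y + 1 : ℤ) : ℝ) = α * M * ((x - y : ℤ) : ℝ) + α * M := by
      push_cast; ring
    rw [h1, h2, Real.sin_sub, Real.sin_add]; ring
  have d1' := congrArg (fun r : ℝ => (r : ℂ)) d1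
  have d2' := congrArg (fun r : ℝ => (r : ℂ)) d2
  have d3' := congrArg (fun r : ℝ => (r : ℂ)) d3
  have t' := congrArg (fun r : ℝ => (r : ℂ)) t
  simp only [Complex.ofReal_sub, Complex.ofReal_add, Complex.ofReal_mul, Complex.ofReal_neg,
    Complex.ofReal_ofNat] at d1' d2' d3' t'
  linear_combination dirichletKer M α (x - y - 1) * d1' + dirichletKer M α (x - y) * d2' +
    dirichletKer M α (x - y + 1) * d3' - S * s1 + 2 * (Real.cos (α * M) : ℂ) * S * s2 - S * s3
    - S * t'

theorem offCoeff_zero (N : ℕ) (α : ℝ) : offCoeff N α 0 = 0 := by simp [offCoeff]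

theorem offCoeff_self (N : ℕ) (α : ℝ) : offCoeff N α N = 0 := by simp [offCoeff]

/-- Summation by parts, whose boundary terms vanish because the off-diagonal coefficient is zero at
`0` and at `N`. It holds at every integer `x`, also outside the support; this is what the extension
argument needs. -/
theorem triOp_kerConv (N M : ℕ) (α : ℝ) (v : ℤ → ℂ) (x : ℤ) :
    triOp (diagCoeff N M α) (offCoeff N α) (kerConv N M α v) x =
      kerConv N M α (triOp (diagCoeff N M α) (offCoeff N α) v) x := by
  have tel1 := sum_range_sub
    (fun j : ℕ => (offCoeff N α j : ℂ) * dirichletKer M α (x - (j - 1)) * v j) N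
  have tel2 := sum_range_sub
    (fun j : ℕ => (offCoeff N α j : ℂ) * dirichletKer M α (x - j) * v (j - 1)) N
  have z0 : (offCoeff N α ((0 : ℕ) : ℤ) : ℂ) = 0 := by simp [offCoeff_zero]
  simp only [offCoeff_self, z0, Complex.ofReal_zero, zero_mul, sub_zero] at tel1 tel2
  have L : triOp (diagCoeff N M α) (offCoeff N α) (kerConv N M α v) x =
      ∑ j ∈ range N, ((offCoeff N α j : ℂ) * dirichletKer M α (x - (j - 1)) +
        diagCoeff N M α j * dirichletKer M α (x - j) +
        offCoeff N α (j + 1) * dirichletKer M α (x - (j + 1))) * v j := by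
    simp only [triOp, kerConv, mul_sum, ← sum_add_distrib]
    refine sum_congr rfl fun j _ => ?_
    rw [← dirichletKer_comm]; ring
  rw [L, ← sub_eq_zero, kerConv, ← sum_sub_distrib]
  have : ∑ j ∈ range N, (((offCoeff N α ((j + 1 : ℕ) : ℤ) : ℂ) *
        dirichletKer M α (x - (((j + 1 : ℕ) : ℤ) - 1)) * v ((j + 1 : ℕ) : ℤ) -
        (offCoeff N α j : ℂ) * dirichletKer M α (x - (j - 1)) * v j)
      - (((offCoeff N α ((j + 1 : ℕ) : ℤ) : ℂ) *
        dirichletKer M α (x - ((j + 1 : ℕ) : ℤ)) * v (((j + 1 : ℕ) : ℤ) - 1) -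
        (offCoeff N α j : ℂ) * dirichletKer M α (x - j) * v (j - 1)))) = 0 := by
    rw [sum_sub_distrib, tel1, tel2, sub_zero]
  rw [← neg_eq_zero, ← this, ← sum_neg_distrib]
  refine sum_congr rfl fun j _ => ?_
  have e : (((j + 1 : ℕ) : ℤ) - 1) = j := by push_cast; ring
  rw [e]; push_cast
  simp only [triOp]
  ring

theorem kerConv_congr {N M : ℕ} {α : ℝ} {u v : ℤ → ℂ} (h : ∀ j : ℕ, j < N → u j = v j) (x : ℤ) :
    kerConv N M α u x = kerConv N M α v x :=
  sum_congr rfl fun j hj => by rw [h j (mem_range.1 hj)]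

theorem kerConv_smul (N M : ℕ) (α : ℝ) (a : ℂ) (v : ℤ → ℂ) (x : ℤ) :
    kerConv N M α (fun y => a * v y) x = a * kerConv N M α v x := by
  simp only [kerConv, mul_sum]
  exact sum_congr rfl fun j _ => by ring

theorem kerConv_sub (N M : ℕ) (α : ℝ) (u v : ℤ → ℂ) (x : ℤ) :
    kerConv N M α (fun y => u y - v y) x = kerConv N M α u x - kerConv N M α v x := by
  simp only [kerConv, mul_sub, sum_sub_distrib]

/-- The kernel is even, so convolution is symmetric and a shift changes sides with opposite sign. -/
theorem kerConv_shift (N M : ℕ) (α : ℝ) (u v : ℤ → ℂ) (s : ℤ) :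
    ∑ j ∈ range N, kerConv N M α u (j + s) * v j =
      ∑ j ∈ range N, u j * kerConv N M α v (j - s) := by
  simp only [kerConv, sum_mul, mul_sum]
  rw [sum_comm]
  refine sum_congr rfl fun i _ => sum_congr rfl fun j _ => ?_
  rw [show (i : ℤ) - s - j = -((j : ℤ) + s - i) by ring, dirichletKer_neg]
  ring

theorem triOp_kerConv_of_eigen {N M : ℕ} {α : ℝ} {v : ℤ → ℂ} {θ : ℂ}
    (h : ∀ j : ℕ, j < N → triOp (diagCoeff N M α) (offCoeff N α) v j = θ * v j) (x : ℤ) :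
    triOp (diagCoeff N M α) (offCoeff N α) (kerConv N M α v) x = θ * kerConv N M α v x := by
  rw [triOp_kerConv, ← kerConv_smul]
  exact kerConv_congr h x

end PeriodicProlate

/-! ### Unreduced tridiagonal recurrences and sums of exponentials -/

namespace PeriodicProlate

open Finset

/-- The recurrence is solved downwards from the last entry, dividing by the nonzero off-diagonal
coefficient at each step. -/
theorem eq_zero_of_triOp_eigen {n : ℕ} {c b : ℤ → ℝ} {v : ℤ → ℂ} {θ : ℂ}
    (hb : ∀ j : ℕ, 1 ≤ j → j ≤ n → b j ≠ 0) (hbn : b (n + 1) = 0)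
    (h : ∀ j : ℕ, j ≤ n → triOp c b v j = θ * v j) (hv : v n = 0) :
    ∀ j : ℕ, j ≤ n → v j = 0 := by
  have key : ∀ k j : ℕ, j + k = n → v j = 0 := by
    intro k
    induction k using Nat.strong_induction_on with
    | _ k ih =>
      intro j hj
      rcases k with _ | k
      · obtain rfl : j = n := by omega
        exact hv
      · have e := h (j + 1) (by omega)
        have h1 : v ((j + 1 : ℕ) : ℤ) = 0 := ih k (by omega) (j + 1) (by omega)
        have h2 : (b (((j + 1 : ℕ) : ℤ) + 1) : ℂ) * v (((j + 1 : ℕ) : ℤ) + 1) = 0 := by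
          rcases k with _ | k
          · have : (((j + 1 : ℕ) : ℤ) + 1) = n + 1 := by omega
            rw [this, hbn]; simp
          · have h3 := ih k (by omega) (j + 2) (by omega)
            have : (((j + 1 : ℕ) : ℤ) + 1) = ((j + 2 : ℕ) : ℤ) := by push_cast; ring
            rw [this, h3, mul_zero]
        rw [triOp, h1, h2] at e
        simp only [mul_zero, add_zero, mul_eq_zero] at e
        have h4 : (((j + 1 : ℕ) : ℤ) - 1) = j := by push_cast; ring
        rw [h4] at e
        rcases e with e | e
        · exact absurd (Complex.ofReal_eq_zero.1 e) (hb (j + 1) (by omega) (by omega))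
        · exact e
  exact fun j hj => key (n - j) j (by omega)

theorem triOp_sub_smul (c b : ℤ → ℝ) (p q : ℂ) (u v : ℤ → ℂ) (x : ℤ) :
    triOp c b (fun y => p * u y - q * v y) x = p * triOp c b u x - q * triOp c b v x := by
  simp only [triOp]; ring

/-- Two eigenvectors of an unreduced tridiagonal matrix with the same eigenvalue are
proportional. -/
theorem proportional_of_triOp_eigen {n : ℕ} {c b : ℤ → ℝ} {u v : ℤ → ℂ} {θ : ℂ}
    (hb : ∀ j : ℕ, 1 ≤ j → j ≤ n → b j ≠ 0) (hbn : b (n + 1) = 0)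
    (hu : ∀ j : ℕ, j ≤ n → triOp c b u j = θ * u j)
    (hv : ∀ j : ℕ, j ≤ n → triOp c b v j = θ * v j) :
    ∀ j : ℕ, j ≤ n → v n * u j = u n * v j := by
  intro j hj
  have := eq_zero_of_triOp_eigen (v := fun y => v n * u y - u n * v y) hb hbn (θ := θ)
    (fun i hi => by rw [triOp_sub_smul, hu i hi, hv i hi]; ring) (by ring) j hj
  exact sub_eq_zero.1 this

/-- Neighbouring frequencies differ by `2α`, so all of them span less than a full period `2π`. -/
theorem exp_freq_injOn {M : ℕ} {α : ℝ} (hα : 0 < α) (hM : ((M : ℝ) - 1) * α < Real.pi)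
    {l l' : ℕ} (hl : l < M) (hl' : l' < M)
    (h : Complex.exp ((freq M α l : ℂ) * Complex.I) = Complex.exp ((freq M α l' : ℂ) * Complex.I)) :
    l = l' := by
  obtain ⟨k, hk⟩ := Complex.exp_eq_exp_iff_exists_int.1 h
  have hk' : freq M α l = freq M α l' + k * (2 * Real.pi) := by
    have : ((freq M α l : ℂ)) * Complex.I =
        ((freq M α l' + k * (2 * Real.pi) : ℝ) : ℂ) * Complex.I := by
      rw [hk]; push_cast; ring
    exact_mod_cast mul_right_cancel₀ Complex.I_ne_zero this
  have e : α * ((l : ℝ) - l') = k * Real.pi := by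
    simp only [freq] at hk'; linarith
  have b1 : (l : ℝ) - l' ≤ M - 1 := by
    have h1 : (l : ℝ) + 1 ≤ M := by exact_mod_cast hl
    have h2 : (0 : ℝ) ≤ l' := by positivity
    linarith
  have b2 : (l' : ℝ) - l ≤ M - 1 := by
    have h1 : (l' : ℝ) + 1 ≤ M := by exact_mod_cast hl'
    have h2 : (0 : ℝ) ≤ l := by positivity
    linarith
  have hp := Real.pi_pos
  have k1 : (k : ℝ) < 1 := by
    have : (k : ℝ) * Real.pi < 1 * Real.pi := by rw [← e]; nlinarith
    exact lt_of_mul_lt_mul_right this hp.le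
  have k2 : (-1 : ℝ) < k := by
    have : (-1 : ℝ) * Real.pi < k * Real.pi := by rw [← e]; nlinarith
    exact lt_of_mul_lt_mul_right this hp.le
  have k0 : k = 0 := by
    have : k < 1 := by exact_mod_cast k1
    have : -1 < k := by exact_mod_cast k2
    omega
  rw [k0] at e
  simp only [Int.cast_zero, zero_mul, mul_eq_zero, hα.ne', false_or] at e
  exact_mod_cast sub_eq_zero.1 e

theorem kerConv_eq_sum_freq (N M : ℕ) (α : ℝ) (v : ℤ → ℂ) (x : ℤ) :
    kerConv N M α v x = ∑ l : Fin M,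
      (∑ j ∈ range N, Complex.exp (((-(freq M α l * j) : ℝ) : ℂ) * Complex.I) * v j) *
        Complex.exp (((freq M α l * x : ℝ) : ℂ) * Complex.I) := by
  simp only [kerConv, dirichletKer, ← Fin.sum_univ_eq_sum_range
    (fun l => Complex.exp (((freq M α l * ((x - _ : ℤ) : ℝ) : ℝ) : ℂ) * Complex.I)), sum_mul]
  rw [sum_comm]
  refine sum_congr rfl fun l _ => sum_congr rfl fun j _ => ?_
  rw [mul_right_comm, ← Complex.exp_add]
  congr 2
  push_cast; ring

/-- A trigonometric sum with `M` frequencies that vanishes at `M` consecutive points vanishes. -/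
theorem kerConv_eq_zero_of_consecutive {N M : ℕ} {α : ℝ} (hα : 0 < α)
    (hM : ((M : ℝ) - 1) * α < Real.pi) {v : ℤ → ℂ} {x₀ : ℤ}
    (h : ∀ k : ℕ, k < M → kerConv N M α v (x₀ + k) = 0) (x : ℤ) : kerConv N M α v x = 0 := by
  set C : Fin M → ℂ := fun l =>
    ∑ j ∈ range N, Complex.exp (((-(freq M α l * j) : ℝ) : ℂ) * Complex.I) * v j
  -- The `M` consecutive values form a Vandermonde system with distinct nodes, so every weighted
  -- coefficient vanishes.
  have hz : (fun l : Fin M => C l * Complex.exp (((freq M α l * x₀ : ℝ) : ℂ) * Complex.I)) = 0 := by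
    refine Matrix.eq_zero_of_forall_pow_sum_mul_pow_eq_zero
      (f := fun l : Fin M => Complex.exp ((freq M α l : ℂ) * Complex.I)) ?_ ?_
    · intro l l' hll
      exact Fin.ext (exp_freq_injOn hα hM l.2 l'.2 hll)
    · intro k
      rw [← h k k.2, kerConv_eq_sum_freq]
      refine sum_congr rfl fun l _ => ?_
      rw [mul_assoc, ← Complex.exp_nat_mul, ← Complex.exp_add]
      congr 2
      push_cast; ring
  rw [kerConv_eq_sum_freq]
  refine sum_eq_zero fun l _ => ?_
  have := congrFun hz l
  simp only [Pi.zero_apply, mul_eq_zero, Complex.exp_ne_zero, or_false] at this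
  change C l * _ = 0
  rw [this, zero_mul]

end PeriodicProlate

/-! ### Distinct nonzero kernel eigenvalues -/

namespace PeriodicProlate

open Finset

theorem offCoeff_ne_zero_of_lt {N : ℕ} {α : ℝ} (hα : 0 < α) (hN : ((N : ℝ) - 1) * α < Real.pi)
    {j : ℕ} (h1 : 1 ≤ j) (h2 : j < N) : offCoeff N α j ≠ 0 := by
  have a1 : (1 : ℝ) ≤ j := by exact_mod_cast h1
  have a2 : (j : ℝ) + 1 ≤ N := by exact_mod_cast h2
  refine mul_ne_zero (Real.sin_pos_of_pos_of_lt_pi ?_ ?_).ne'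
    (Real.sin_pos_of_pos_of_lt_pi ?_ ?_).ne'
  all_goals push_cast; nlinarith

theorem offCoeff_add_ne_zero {N K : ℕ} {α : ℝ} (hα : 0 < α)
    (h : ((N : ℝ) + K) * α < Real.pi) (hK : 1 ≤ K) : offCoeff N α (N + K) ≠ 0 := by
  have a1 : (1 : ℝ) ≤ K := by exact_mod_cast hK
  have a2 : (0 : ℝ) ≤ N := by positivity
  refine mul_ne_zero (Real.sin_pos_of_pos_of_lt_pi ?_ ?_).ne' ?_
  · push_cast; nlinarith
  · push_cast; nlinarith
  · have : α * ((N : ℝ) - (((N : ℤ) + (K : ℤ) : ℤ) : ℝ)) = -(α * K) := by push_cast; ring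
    rw [this, Real.sin_neg, neg_ne_zero]
    exact (Real.sin_pos_of_pos_of_lt_pi (by nlinarith) (by nlinarith)).ne'

/-- If two eigenvectors of the difference operator share a nonzero kernel eigenvalue, then the
extension of the first one vanishes just outside the support. -/
theorem kerConv_boundary_eq_zero {n M : ℕ} {α : ℝ} {u v : ℤ → ℂ} {θ θ' κ : ℂ}
    (hα : 0 < α) (hN : ((n : ℝ) + 2) * α < Real.pi) (hθ : θ ≠ θ')
    (hu : ∀ j : ℕ, j < n + 2 →
      triOp (diagCoeff (n + 2) M α) (offCoeff (n + 2) α) u j = θ * u j)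
    (hv : ∀ j : ℕ, j < n + 2 →
      triOp (diagCoeff (n + 2) M α) (offCoeff (n + 2) α) v j = θ' * v j)
    (ku : ∀ j : ℕ, j < n + 2 → kerConv (n + 2) M α u j = κ * u j)
    (kv : ∀ j : ℕ, j < n + 2 → kerConv (n + 2) M α v j = κ * v j)
    (hv0 : v (n + 1) ≠ 0) : kerConv (n + 2) M α u (n + 2) = 0 := by
  set U := kerConv (n + 2) M α u with hU
  set V := kerConv (n + 2) M α v with hV
  set b := offCoeff (n + 2) α with hb
  set c := diagCoeff (n + 2) M α with hc
  have hUT := triOp_kerConv_of_eigen hu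
  have hVT := triOp_kerConv_of_eigen hv
  rw [← hU, ← hb, ← hc] at hUT
  rw [← hV, ← hb, ← hc] at hVT
  have sh1 := kerConv_shift (n + 2) M α u v 1
  have sh2 := kerConv_shift (n + 2) M α u v 2
  rw [← hU, ← hV] at sh1 sh2
  -- On the support `U = κu` and `V = κv`, so in the identity for shift 1 every term cancels except
  -- those where a point leaves the support.
  have E1 : U (n + 2) * v (n + 1) = u 0 * V (-1) := by
    rw [sum_range_succ _ (n + 1), sum_range_succ' (fun j : ℕ => u j * V (j - 1)) (n + 1)] at sh1
    have : ∑ j ∈ range (n + 1), U ((j : ℤ) + 1) * v j =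
        ∑ j ∈ range (n + 1), u ((j + 1 : ℕ) : ℤ) * V (((j + 1 : ℕ) : ℤ) - 1) := by
      refine sum_congr rfl fun j hj => ?_
      have hj' := mem_range.1 hj
      have a1 := ku (j + 1) (by omega)
      have a2 := kv j (by omega)
      rw [show (((j + 1 : ℕ) : ℤ) - 1) = j by push_cast; ring, a2]
      push_cast at a1 ⊢
      rw [a1]; ring
    rw [this] at sh1
    have := add_left_cancel sh1
    push_cast at this
    rw [show (n : ℤ) + 1 + 1 = n + 2 by ring] at this
    exact this
  -- The same cancellation for shift 2 leaves two boundary terms on each side.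
  have E2 : U (n + 3) * v (n + 1) + U (n + 2) * v n = u 0 * V (-2) + u 1 * V (-1) := by
    rw [sum_range_succ, sum_range_succ, sum_range_succ', sum_range_succ'] at sh2
    have : ∑ j ∈ range n, U ((j : ℤ) + 2) * v j =
        ∑ j ∈ range n, u ((j + 1 + 1 : ℕ) : ℤ) * V (((j + 1 + 1 : ℕ) : ℤ) - 2) := by
      refine sum_congr rfl fun j hj => ?_
      have hj' := mem_range.1 hj
      have a1 := ku (j + 2) (by omega)
      have a2 := kv j (by omega)
      rw [show (((j + 1 + 1 : ℕ) : ℤ) - 2) = j by push_cast; ring, a2,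
        show ((j + 1 + 1 : ℕ) : ℤ) = ((j + 2 : ℕ) : ℤ) by push_cast; ring,
        show (j : ℤ) + 2 = ((j + 2 : ℕ) : ℤ) by push_cast; ring, a1]
      ring
    rw [this] at sh2
    push_cast at sh2
    rw [show (n : ℤ) + 1 + 2 = n + 3 by ring] at sh2
    linear_combination sh2
  -- At each of the four points next to an end of the support, one off-diagonal coefficient vanishes
  -- and the recurrence involves two values only.
  have R1 : (b (n + 1) : ℂ) * v n + c (n + 1) * v (n + 1) = θ' * v (n + 1) := by
    have h := hv (n + 1) (by omega)
    have z : b ((n : ℤ) + 1 + 1) = 0 := by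
      have := offCoeff_self (n + 2) α
      rw [hb]; convert this using 2; push_cast; ring
    rw [triOp] at h
    push_cast at h
    rw [z, show (n : ℤ) + 1 - 1 = n by ring] at h
    simpa using h
  have R2 : (c (n + 2) : ℂ) * U (n + 2) + b (n + 3) * U (n + 3) = θ * U (n + 2) := by
    have h := hUT (n + 2)
    have z : b ((n : ℤ) + 2) = 0 := by
      have := offCoeff_self (n + 2) α
      rw [hb]; convert this using 2; push_cast; ring
    rw [triOp, z, show (n : ℤ) + 2 + 1 = n + 3 by ring] at h
    simpa using h
  have R3 : (c 0 : ℂ) * u 0 + b 1 * u 1 = θ * u 0 := by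
    have h := hu 0 (by omega)
    have z : b 0 = 0 := offCoeff_zero _ _
    rw [triOp] at h
    push_cast at h
    rw [z] at h
    simpa using h
  have R4 : (b (-1) : ℂ) * V (-2) + c (-1) * V (-1) = θ' * V (-1) := by
    have h := hVT (-1)
    have z : b 0 = 0 := offCoeff_zero _ _
    rw [triOp, show (-1 : ℤ) + 1 = 0 by ring, show (-1 : ℤ) - 1 = -2 by ring, z] at h
    simpa using h
  -- The reflection `x ↦ N - 1 - x` preserves the operator, so the coefficients at the two ends
  -- agree.
  have S1 : b 1 = b (n + 1) := by
    simp only [hb, offCoeff]; push_cast; ring_nf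
  have S2 : b (-1) = b (n + 3) := by
    simp only [hb, offCoeff]; push_cast
    rw [mul_comm]
    rw [show α * ((n : ℝ) + 2 - -1) = α * (n + 3) by ring,
      show α * ((n : ℝ) + 2 - (n + 3)) = α * -1 by ring]
  have S3 : c 0 = c (n + 1) := by
    simp only [hc, diagCoeff]; push_cast
    rw [← Real.cos_neg]; ring_nf
  have S4 : c (-1) = c (n + 2) := by
    simp only [hc, diagCoeff]; push_cast
    rw [← Real.cos_neg]; ring_nf
  rw [S1, S3] at R3
  rw [S2, S4] at R4
  -- The recurrences eliminate `U (n + 3)`, `V (-2)`, `v n` and `u 1` from `E2`; then `E1` merges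
  -- the remaining products into one.
  have F : (θ - θ') * ((b (n + 1) : ℂ) - b (n + 3)) * (U (n + 2) * v (n + 1)) = 0 := by
    linear_combination (b (n + 1) : ℂ) * b (n + 3) * E2 - b (n + 3) * U (n + 2) * R1
      - b (n + 1) * v (n + 1) * R2 + b (n + 3) * V (-1) * R3 + b (n + 1) * u 0 * R4
      - (b (n + 1) * (θ' - c (n + 2)) + b (n + 3) * (θ - c (n + 1)) : ℂ) * E1
  have hn0 : (0 : ℝ) ≤ n := by positivity
  have G : (b (n + 1) : ℂ) - b (n + 3) ≠ 0 := by
    have : b (n + 1) - b (n + 3) = 2 * Real.sin α * Real.sin (α * (n + 2)) * Real.cos α := by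
      simp only [hb, offCoeff]; push_cast
      rw [show α * ((n : ℝ) + 2 - (n + 1)) = α by ring,
        show α * ((n : ℝ) + 2 - (n + 3)) = -α by ring,
        show α * ((n : ℝ) + 1) = α * (n + 2) - α by ring,
        show α * ((n : ℝ) + 3) = α * (n + 2) + α by ring,
        Real.sin_sub, Real.sin_add, Real.sin_neg]
      ring
    have h1 := Real.sin_pos_of_pos_of_lt_pi hα (by nlinarith)
    have h2 := Real.sin_pos_of_pos_of_lt_pi (x := α * (n + 2)) (by positivity) (by linarith)
    have h3 := Real.cos_pos_of_mem_Ioo (x := α) ⟨by linarith [Real.pi_pos], by nlinarith⟩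
    have h4 : b (n + 1) - b (n + 3) ≠ 0 := by rw [this]; positivity
    exact_mod_cast h4
  simpa [sub_ne_zero.2 hθ, G, hv0] using F

/-- At `N` the recurrence decouples from the interior, so the single zero there propagates outwards
while the off-diagonal coefficients are nonzero. This yields `M - 1` consecutive zeros. -/
theorem kerConv_exterior_eq_zero {N M : ℕ} {α : ℝ} {u : ℤ → ℂ} {θ : ℂ}
    (hα : 0 < α) (hM : ((M : ℝ) + N - 2) * α < Real.pi)
    (hu : ∀ j : ℕ, j < N → triOp (diagCoeff N M α) (offCoeff N α) u j = θ * u j)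
    (h0 : kerConv N M α u N = 0) : ∀ k : ℕ, k + 2 ≤ M → kerConv N M α u (N + k) = 0 := by
  intro k
  induction k using Nat.strong_induction_on with
  | _ k ih =>
    intro hk
    rcases k with _ | k
    · simpa using h0
    have h := triOp_kerConv_of_eigen hu (N + k)
    have h1 := ih k (by omega) (by omega)
    have h2 : (offCoeff N α (N + k) : ℂ) * kerConv N M α u (N + k - 1) = 0 := by
      rcases k with _ | k
      · have := offCoeff_self N α
        simp [this]
      · have := ih k (by omega) (by omega)
        rw [show (N : ℤ) + ((k + 1 : ℕ) : ℤ) - 1 = N + k by push_cast; ring, this, mul_zero]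
    rw [triOp, h1, h2] at h
    have h3 : offCoeff N α (N + (k + 1 : ℕ)) ≠ 0 := by
      refine offCoeff_add_ne_zero hα (lt_of_le_of_lt ?_ hM) (by omega)
      have : ((k + 1 : ℕ) : ℝ) + 2 ≤ M := by exact_mod_cast hk
      exact mul_le_mul_of_nonneg_right (by linarith) hα.le
    rw [show (N : ℤ) + k + 1 = N + ((k + 1 : ℕ) : ℤ) by push_cast; ring] at h
    simp only [mul_zero, zero_add, mul_eq_zero, Complex.ofReal_eq_zero, h3, false_or] at h
    exact h

/-- Two eigenvectors of the difference operator for distinct eigenvalues have distinct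
kernel eigenvalues unless both of these vanish. -/
theorem kernel_eigenvalue_ne {n M : ℕ} {α : ℝ} {u v : ℤ → ℂ} {θ θ' κ : ℂ}
    (hα : 0 < α) (hN : (n : ℝ) * α < Real.pi)
    (hM : ((M : ℝ) + n - 1) * α < Real.pi) (hθ : θ ≠ θ') (hκ : κ ≠ 0)
    (hu : ∀ j : ℕ, j < n + 1 →
      triOp (diagCoeff (n + 1) M α) (offCoeff (n + 1) α) u j = θ * u j)
    (hv : ∀ j : ℕ, j < n + 1 →
      triOp (diagCoeff (n + 1) M α) (offCoeff (n + 1) α) v j = θ' * v j)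
    (ku : ∀ j : ℕ, j < n + 1 → kerConv (n + 1) M α u j = κ * u j)
    (kv : ∀ j : ℕ, j < n + 1 → kerConv (n + 1) M α v j = κ * v j)
    (hu0 : u n ≠ 0) (hv0 : v n ≠ 0) : False := by
  have hn0 : (0 : ℝ) ≤ n := by positivity
  -- For `M ≤ 1` no exterior zero is needed below. The case `N = 1` is impossible, since a `1 × 1`
  -- matrix has a single eigenvalue.
  have bd : 2 ≤ M → kerConv (n + 1) M α u (n + 1) = 0 ∧ kerConv (n + 1) M α v (n + 1) = 0 := by
    intro hM2
    have hM2' : (2 : ℝ) ≤ M := by exact_mod_cast hM2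
    rcases n with _ | n
    · exfalso
      have a := hu 0 (by omega)
      have b := hv 0 (by omega)
      have z1 := offCoeff_zero (0 + 1) α
      have z2 : offCoeff (0 + 1) α 1 = 0 := by simpa using offCoeff_self (0 + 1) α
      simp only [triOp, Nat.cast_zero, z1, zero_add, z2, Complex.ofReal_zero, zero_mul,
        add_zero] at a b
      exact hθ ((mul_right_cancel₀ hu0 a).symm.trans (mul_right_cancel₀ hv0 b))
    · have hN' : ((n : ℝ) + 2) * α < Real.pi := by
        refine lt_of_le_of_lt (mul_le_mul_of_nonneg_right ?_ hα.le) hM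
        push_cast; linarith
      push_cast at hu0 hv0
      have e : (((n + 1 : ℕ) : ℤ) + 1) = n + 2 := by push_cast; ring
      rw [e]
      exact ⟨kerConv_boundary_eq_zero hα hN' hθ hu hv ku kv hv0,
        kerConv_boundary_eq_zero hα hN' hθ.symm hv hu kv ku hu0⟩
  set w : ℤ → ℂ := fun y => v n * u y - u n * v y with hw
  have kw : ∀ x, kerConv (n + 1) M α w x =
      v n * kerConv (n + 1) M α u x - u n * kerConv (n + 1) M α v x := by
    intro x
    rw [hw, kerConv_sub, kerConv_smul, kerConv_smul]
  have hM' : ((M : ℝ) + ((n + 1 : ℕ) : ℝ) - 2) * α < Real.pi := by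
    convert hM using 2; push_cast; ring
  -- The combination `w` vanishes at the last support point by construction, which adds the missing
  -- zero to the `M - 1` exterior ones.
  have cons : ∀ k : ℕ, k < M → kerConv (n + 1) M α w ((n : ℤ) + k) = 0 := by
    intro k hk
    rcases k with _ | k
    · rw [kw, Nat.cast_zero, add_zero, ku n (by omega), kv n (by omega)]; ring
    · obtain ⟨b1, b2⟩ := bd (by omega)
      have a1 := kerConv_exterior_eq_zero hα hM' hu (by push_cast; exact b1) k (by omega)
      have a2 := kerConv_exterior_eq_zero hα hM' hv (by push_cast; exact b2) k (by omega)
      have e : (n : ℤ) + ((k + 1 : ℕ) : ℤ) = ((n + 1 : ℕ) : ℤ) + k := by push_cast; ring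
      rw [kw, e, a1, a2]; ring
  have all := kerConv_eq_zero_of_consecutive hα
    (lt_of_le_of_lt (mul_le_mul_of_nonneg_right (by linarith) hα.le) hM) cons
  have wz : ∀ j : ℕ, j < n + 1 → v n * u j = u n * v j := by
    intro j hj
    have := all j
    rw [kw, ku j hj, kv j hj] at this
    have h2 : κ * (v n * u j - u n * v j) = 0 := by linear_combination this
    exact sub_eq_zero.1 ((mul_eq_zero.1 h2).resolve_left hκ)
  -- As `w` vanishes on the support, so does its image at `n`; but that image equals `(θ - θ') * (u
  -- n * v n)`.
  have T1 : triOp (diagCoeff (n + 1) M α) (offCoeff (n + 1) α) w n = 0 := by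
    have z : offCoeff (n + 1) α ((n : ℤ) + 1) = 0 := by
      have := offCoeff_self (n + 1) α
      push_cast at this; exact this
    have w0 : w n = 0 := by simp only [hw]; ring
    have w1 : (offCoeff (n + 1) α n : ℂ) * w (n - 1) = 0 := by
      rcases n with _ | n
      · simp [offCoeff_zero]
      · have := wz n (by omega)
        have e : (((n + 1 : ℕ) : ℤ) - 1) = n := by push_cast; ring
        simp only [hw, e, this, sub_self, mul_zero]
    rw [triOp, z, w0, w1]; simp
  rw [hw, triOp_sub_smul, hu n (by omega), hv n (by omega)] at T1
  have : (θ - θ') * (u n * v n) = 0 := by linear_combination T1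
  simp [sub_ne_zero.2 hθ, hu0, hv0] at this

end PeriodicProlate

/-! ### Matrix form of the operators -/

namespace PeriodicProlate

open Finset Matrix

/-- Extension by zero of a finite vector to the integers. -/
noncomputable def zext {N : ℕ} (v : Fin N → ℂ) (x : ℤ) : ℂ :=
  if h : 0 ≤ x ∧ x < N then v ⟨x.toNat, by omega⟩ else 0

theorem zext_natCast {N : ℕ} (v : Fin N → ℂ) {j : ℕ} (hj : j < N) : zext v j = v ⟨j, hj⟩ := by
  rw [zext, dif_pos ⟨by omega, by omega⟩]; rfl

@[simp]
theorem zext_fin {N : ℕ} (v : Fin N → ℂ) (i : Fin N) : zext v (i : ℕ) = v i := zext_natCast v i.2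

theorem zext_of_le {N : ℕ} (v : Fin N → ℂ) {x : ℤ} (hx : (N : ℤ) ≤ x) : zext v x = 0 :=
  dif_neg (by omega)

theorem zext_of_neg {N : ℕ} (v : Fin N → ℂ) {x : ℤ} (hx : x < 0) : zext v x = 0 :=
  dif_neg (by omega)

/-- The symmetric tridiagonal matrix with diagonal `c_0, …, c_{N-1}` and off-diagonal
`b_1, …, b_{N-1}`. -/
noncomputable def triMat (N : ℕ) (c b : ℤ → ℝ) : Matrix (Fin N) (Fin N) ℂ :=
  Matrix.of fun i j => ((if (i : ℕ) = j then c (i : ℕ)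
    else if (i : ℕ) + 1 = j then b (j : ℕ)
    else if (j : ℕ) + 1 = i then b (i : ℕ)
    else 0 : ℝ) : ℂ)

theorem triMat_mulVec {N : ℕ} (c b : ℤ → ℝ) (v : Fin N → ℂ) (i : Fin N) :
    (triMat N c b *ᵥ v) i = triOp c b (zext v) (i : ℕ) := by
  have h1 : (triMat N c b *ᵥ v) i = ∑ j ∈ range N,
      ((if j = (i : ℕ) then (c (i : ℕ) : ℂ) * zext v (i : ℕ) else 0) +
       (if j = (i : ℕ) + 1 then (b ((i : ℕ) + 1) : ℂ) * zext v ((i : ℕ) + 1) else 0) +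
       (if j + 1 = (i : ℕ) then (b (i : ℕ) : ℂ) * zext v ((i : ℕ) - 1) else 0)) := by
    rw [← Fin.sum_univ_eq_sum_range (fun j : ℕ =>
      ((if j = (i : ℕ) then (c (i : ℕ) : ℂ) * zext v (i : ℕ) else 0) +
       (if j = (i : ℕ) + 1 then (b ((i : ℕ) + 1) : ℂ) * zext v ((i : ℕ) + 1) else 0) +
       (if j + 1 = (i : ℕ) then (b (i : ℕ) : ℂ) * zext v ((i : ℕ) - 1) else 0)))]
    simp only [mulVec, dotProduct, triMat, of_apply]
    refine sum_congr rfl fun j _ => ?_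
    rw [← zext_fin v j]
    rcases lt_trichotomy (j : ℕ) i with h | h | h
    · simp only [show ¬ (i : ℕ) = j by omega, show ¬ (i : ℕ) + 1 = j by omega,
        show ¬ (j : ℕ) = i by omega, show ¬ (j : ℕ) = (i : ℕ) + 1 by omega, if_false]
      by_cases h' : (j : ℕ) + 1 = i
      · rw [if_pos h', if_pos h', show ((i : ℕ) : ℤ) - 1 = (j : ℕ) by omega]; ring
      · rw [if_neg h', if_neg h']; simp
    · simp only [h, show ¬ (i : ℕ) = (i : ℕ) + 1 by omega, show ¬ (i : ℕ) + 1 = i by omega,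
        if_false, if_true]
      ring
    · simp only [show ¬ (i : ℕ) = j by omega, show ¬ (j : ℕ) + 1 = i by omega,
        show ¬ (j : ℕ) = i by omega, if_false]
      by_cases h' : (i : ℕ) + 1 = j
      · rw [if_pos h', if_pos h'.symm, show ((i : ℕ) : ℤ) + 1 = (j : ℕ) by omega]; ring
      · rw [if_neg h', if_neg (by omega)]; simp
  rw [h1, sum_add_distrib, sum_add_distrib, sum_ite_eq', sum_ite_eq',
    if_pos (mem_range.2 i.2), triOp]
  have h2 : (if (i : ℕ) + 1 ∈ range N then (b ((i : ℕ) + 1) : ℂ) * zext v ((i : ℕ) + 1) else 0) =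
      (b ((i : ℕ) + 1) : ℂ) * zext v ((i : ℕ) + 1) := by
    split_ifs with h
    · rfl
    · rw [mem_range] at h
      rw [zext_of_le v (by omega), mul_zero]
  have h3 : ∑ j ∈ range N, (if j + 1 = (i : ℕ) then (b (i : ℕ) : ℂ) * zext v ((i : ℕ) - 1) else 0)
      = (b (i : ℕ) : ℂ) * zext v ((i : ℕ) - 1) := by
    by_cases h : (i : ℕ) = 0
    · rw [zext_of_neg v (by omega), mul_zero]
      simp
    · have : ∀ j : ℕ, j + 1 = (i : ℕ) ↔ j = (i : ℕ) - 1 := by omega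
      simp only [this, sum_ite_eq', mem_range]
      rw [if_pos (by omega)]
  rw [h2, h3]
  ring

/-- The trigonometric system whose Gram matrix is the Dirichlet kernel matrix. -/
noncomputable def trigMat (N M : ℕ) (α : ℝ) : Matrix (Fin M) (Fin N) ℂ :=
  Matrix.of fun l j => Complex.exp (((freq M α l * j : ℝ) : ℂ) * Complex.I)

/-- The Dirichlet kernel matrix. -/
noncomputable def kerMat (N M : ℕ) (α : ℝ) : Matrix (Fin N) (Fin N) ℂ :=
  Matrix.of fun i j => dirichletKer M α ((i : ℕ) - (j : ℕ))

theorem trigMat_conjTranspose_mul (N M : ℕ) (α : ℝ) :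
    (trigMat N M α)ᴴ * trigMat N M α = kerMat N M α := by
  ext i j
  rw [kerMat, of_apply, ← dirichletKer_neg, dirichletKer,
    ← Fin.sum_univ_eq_sum_range (fun l =>
      Complex.exp (((freq M α l * ((-(((i : ℕ) : ℤ) - (j : ℕ)) : ℤ) : ℝ) : ℝ) : ℂ) * Complex.I)),
    mul_apply]
  refine sum_congr rfl fun l _ => ?_
  rw [conjTranspose_apply, trigMat, of_apply, of_apply, Complex.star_def, ← Complex.exp_conj,
    ← Complex.exp_add]
  congr 1
  simp only [map_mul, Complex.conj_ofReal, Complex.conj_I]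
  push_cast; ring

theorem kerMat_mulVec {N M : ℕ} (α : ℝ) (v : Fin N → ℂ) (i : Fin N) :
    (kerMat N M α *ᵥ v) i = kerConv N M α (zext v) (i : ℕ) := by
  rw [kerConv, ← Fin.sum_univ_eq_sum_range
    (fun j : ℕ => dirichletKer M α (((i : ℕ) : ℤ) - j) * zext v j), mulVec, dotProduct]
  exact sum_congr rfl fun j _ => by rw [zext_fin]; rfl

/-- The tridiagonal matrix commuting with the Dirichlet kernel matrix. -/
noncomputable abbrev prolateMat (N M : ℕ) (α : ℝ) : Matrix (Fin N) (Fin N) ℂ :=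
  triMat N (diagCoeff N M α) (offCoeff N α)

/-- Zero extensions agree with other sequences only on the support; the vanishing end coefficients
make that sufficient. -/
theorem triOp_congr {N : ℕ} {c b : ℤ → ℝ} (h0 : b 0 = 0) (hN : b N = 0) {u v : ℤ → ℂ}
    (h : ∀ j : ℕ, j < N → u j = v j) {j : ℕ} (hj : j < N) : triOp c b u j = triOp c b v j := by
  rw [triOp, triOp, h j hj]
  have h1 : (b j : ℂ) * u (j - 1) = b j * v (j - 1) := by
    rcases j with _ | j
    · simp [h0]
    · rw [show ((j + 1 : ℕ) : ℤ) - 1 = j by push_cast; ring, h j (by omega)]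
  have h2 : (b (j + 1) : ℂ) * u (j + 1) = b (j + 1) * v (j + 1) := by
    rcases Nat.lt_or_ge (j + 1) N with h' | h'
    · have := h (j + 1) h'
      push_cast at this
      rw [this]
    · have : (j : ℤ) + 1 = N := by omega
      rw [this, hN]; simp
  rw [h1, h2]

theorem prolateMat_commute (N M : ℕ) (α : ℝ) : Commute (kerMat N M α) (prolateMat N M α) := by
  refine Matrix.toLin'.injective (LinearMap.ext fun v => ?_)
  simp only [Matrix.toLin'_apply, ← Matrix.mulVec_mulVec]
  ext i
  rw [kerMat_mulVec, triMat_mulVec,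
    triOp_congr (offCoeff_zero N α) (offCoeff_self N α) (v := kerConv N M α (zext v))
      (fun j hj => by rw [zext_natCast _ hj, kerMat_mulVec]) i.2, triOp_kerConv]
  exact kerConv_congr (fun j hj => by rw [zext_natCast _ hj, triMat_mulVec]) _

theorem eigen_iff_triOp {N : ℕ} {c b : ℤ → ℝ} {v : Fin N → ℂ} {θ : ℂ} :
    triMat N c b *ᵥ v = θ • v ↔ ∀ j : ℕ, j < N → triOp c b (zext v) j = θ * zext v j := by
  constructor
  · intro h j hj
    have := congrFun h ⟨j, hj⟩
    rw [triMat_mulVec] at this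
    rw [this, zext_natCast v hj]; rfl
  · intro h
    ext i
    rw [triMat_mulVec, h i i.2, zext_fin]; rfl

theorem eigen_iff_kerConv {N M : ℕ} {α : ℝ} {v : Fin N → ℂ} {κ : ℂ} :
    kerMat N M α *ᵥ v = κ • v ↔ ∀ j : ℕ, j < N → kerConv N M α (zext v) j = κ * zext v j := by
  constructor
  · intro h j hj
    have := congrFun h ⟨j, hj⟩
    rw [kerMat_mulVec] at this
    rw [this, zext_natCast v hj]; rfl
  · intro h
    ext i
    rw [kerMat_mulVec, h i i.2, zext_fin]; rfl

/-- A tridiagonal coefficient sequence is unreduced when the off-diagonal entries of the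
`(n+1) × (n+1)` matrix do not vanish, and the entry just outside does. -/
def Unreduced (n : ℕ) (b : ℤ → ℝ) : Prop :=
  (∀ j : ℕ, 1 ≤ j → j ≤ n → b j ≠ 0) ∧ b (n + 1) = 0

theorem last_ne_zero {n : ℕ} {c b : ℤ → ℝ} (hb : Unreduced n b) {v : Fin (n + 1) → ℂ} {θ : ℂ}
    (h : triMat (n + 1) c b *ᵥ v = θ • v) (hv : v ≠ 0) : v (Fin.last n) ≠ 0 := by
  intro h0
  refine hv (funext fun i => ?_)
  rw [← zext_fin v i]
  refine eq_zero_of_triOp_eigen hb.1 hb.2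
    (fun j hj => eigen_iff_triOp.1 h j (Nat.lt_succ_of_le hj)) ?_ i (Nat.le_of_lt_succ i.2)
  rw [zext_natCast v (Nat.lt_succ_self n)]
  exact h0

theorem eigen_proportional {n : ℕ} {c b : ℤ → ℝ} (hb : Unreduced n b) {u v : Fin (n + 1) → ℂ}
    {θ : ℂ} (hu : triMat (n + 1) c b *ᵥ u = θ • u) (hv : triMat (n + 1) c b *ᵥ v = θ • v) :
    v (Fin.last n) • u = u (Fin.last n) • v := by
  ext i
  have := proportional_of_triOp_eigen hb.1 hb.2
    (fun j hj => eigen_iff_triOp.1 hu j (Nat.lt_succ_of_le hj))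
    (fun j hj => eigen_iff_triOp.1 hv j (Nat.lt_succ_of_le hj)) i (Nat.le_of_lt_succ i.2)
  rwa [zext_fin, zext_fin, zext_natCast _ (Nat.lt_succ_self n),
    zext_natCast _ (Nat.lt_succ_self n)] at this

/-- Eigenvalues of a matrix transfer between proportional eigenvectors. -/
theorem eigen_transfer {n : ℕ} {c b : ℤ → ℝ} (hb : Unreduced n b) {u v : Fin (n + 1) → ℂ}
    {θ κ : ℂ} {K : Matrix (Fin (n + 1)) (Fin (n + 1)) ℂ}
    (hu : triMat (n + 1) c b *ᵥ u = θ • u) (hv : triMat (n + 1) c b *ᵥ v = θ • v)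
    (hu0 : u ≠ 0) (hK : K *ᵥ u = κ • u) : K *ᵥ v = κ • v := by
  have p := eigen_proportional hb hu hv
  have h0 := last_ne_zero hb hu hu0
  refine smul_right_injective _ h0 ?_
  change u (Fin.last n) • (K *ᵥ v) = u (Fin.last n) • (κ • v)
  rw [← mulVec_smul, ← p, mulVec_smul, hK, smul_comm _ κ u, p, smul_comm]

/-- `K` preserves the eigenspaces of the tridiagonal matrix, and these are lines. -/
theorem exists_eigen_of_commute {n : ℕ} {c b : ℤ → ℝ} (hb : Unreduced n b)
    {u : Fin (n + 1) → ℂ} {θ : ℂ} {K : Matrix (Fin (n + 1)) (Fin (n + 1)) ℂ}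
    (hK : Commute K (triMat (n + 1) c b))
    (hu : triMat (n + 1) c b *ᵥ u = θ • u) (hu0 : u ≠ 0) : ∃ κ : ℂ, K *ᵥ u = κ • u := by
  have h1 : triMat (n + 1) c b *ᵥ (K *ᵥ u) = θ • (K *ᵥ u) := by
    rw [mulVec_mulVec, ← hK.eq, ← mulVec_mulVec, hu, mulVec_smul]
  have p := eigen_proportional hb h1 hu
  have h0 := last_ne_zero hb hu hu0
  refine ⟨(K *ᵥ u) (Fin.last n) / u (Fin.last n), ?_⟩
  refine smul_right_injective _ h0 ?_
  change u (Fin.last n) • (K *ᵥ u) = _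
  change _ = u (Fin.last n) • (((K *ᵥ u) (Fin.last n) / u (Fin.last n)) • u)
  rw [p, smul_smul, mul_div_cancel₀ _ h0]

end PeriodicProlate

/-! ### Sorted eigenbases and their energies -/

namespace PeriodicProlate

open Finset Matrix

/-- Fewer linear conditions than unknowns, with the unknowns supported on `s`. -/
theorem exists_ne_zero_supported {N p : ℕ} (s : Finset (Fin N)) (hs : p < s.card)
    (A : Fin p → Fin N → ℂ) :
    ∃ c : Fin N → ℂ, c ≠ 0 ∧ (∀ i ∉ s, c i = 0) ∧ ∀ k, ∑ i, A k i * c i = 0 := by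
  let B : Matrix (Fin p) s ℂ := Matrix.of fun k i => A k i
  have hlt : Module.finrank ℂ (Fin p → ℂ) < Module.finrank ℂ (s → ℂ) := by
    simpa using hs
  obtain ⟨d, hd, hd0⟩ := (Submodule.ne_bot_iff _).1
    (LinearMap.ker_ne_bot_of_finrank_lt (f := Matrix.toLin' B) hlt)
  refine ⟨fun i => if h : i ∈ s then d ⟨i, h⟩ else 0, ?_, fun i hi => dif_neg hi, fun k => ?_⟩
  · intro h0
    apply hd0
    ext i
    have := congrFun h0 i
    simpa using this
  · have h1 := congrFun (LinearMap.mem_ker.1 hd) k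
    rw [Matrix.toLin'_apply, mulVec, dotProduct] at h1
    rw [← Finset.sum_subset (Finset.subset_univ s), ← Finset.sum_coe_sort s]
    · rw [Pi.zero_apply] at h1
      rw [← h1]
      refine sum_congr rfl fun i _ => ?_
      simp [B]
    · intro i _ hi
      simp [hi]

/-- Rayleigh quotient of a unit vector. -/
noncomputable def ray {N : ℕ} (S : Matrix (Fin N) (Fin N) ℂ) (v : Fin N → ℂ) : ℝ :=
  (star v ⬝ᵥ (S *ᵥ v)).re

/-- Orthonormality of a family of complex vectors. -/
def IsOrtho {N : ℕ} (Φ : Fin N → Fin N → ℂ) : Prop :=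
  ∀ i j, star (Φ i) ⬝ᵥ Φ j = if i = j then 1 else 0

/-- An orthonormal eigenbasis, sorted by decreasing eigenvalues. -/
structure IsFrame {N : ℕ} (S : Matrix (Fin N) (Fin N) ℂ) (Φ : Fin N → Fin N → ℂ) : Prop where
  ortho : IsOrtho Φ
  eigen : ∀ i, S *ᵥ Φ i = (ray S (Φ i) : ℂ) • Φ i
  anti : Antitone fun i => ray S (Φ i)

theorem IsOrtho.ne_zero {N : ℕ} {Φ : Fin N → Fin N → ℂ} (h : IsOrtho Φ) (i : Fin N) :
    Φ i ≠ 0 := by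
  intro h0
  have := h i i
  simp [h0] at this

theorem IsOrtho.ray_eq {N : ℕ} {Φ : Fin N → Fin N → ℂ} (h : IsOrtho Φ)
    {S : Matrix (Fin N) (Fin N) ℂ} {i : Fin N} {s : ℝ} (hs : S *ᵥ Φ i = (s : ℂ) • Φ i) :
    ray S (Φ i) = s := by
  rw [ray, hs, dotProduct_smul, h i i]; simp

theorem IsOrtho.dotProduct_combination {N : ℕ} {Φ : Fin N → Fin N → ℂ} (h : IsOrtho Φ) (c : Fin N → ℂ)
    (k : Fin N) : star (Φ k) ⬝ᵥ (∑ i, c i • Φ i) = c k := by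
  rw [dotProduct_sum]
  simp [dotProduct_smul, h k]

theorem IsOrtho.expand {N : ℕ} {Φ : Fin N → Fin N → ℂ} (h : IsOrtho Φ) (v : Fin N → ℂ) :
    v = ∑ i, (star (Φ i) ⬝ᵥ v) • Φ i := by
  let U : Matrix (Fin N) (Fin N) ℂ := Matrix.of fun i x => star (Φ i x)
  have h1 : U * Uᴴ = 1 := by
    ext i j
    rw [mul_apply, Matrix.one_apply, ← h i j, dotProduct]
    exact sum_congr rfl fun x _ => by simp [U]
  -- Orthonormality is a one-sided inverse; for square matrices it is two-sided, which gives
  -- completeness.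
  have h2 : Uᴴ * U = 1 := mul_eq_one_comm.1 h1
  have h3 : Uᴴ *ᵥ (U *ᵥ v) = v := by rw [mulVec_mulVec, h2, one_mulVec]
  conv_lhs => rw [← h3]
  ext x
  rw [mulVec, dotProduct, Finset.sum_apply]
  refine sum_congr rfl fun i _ => ?_
  simp only [conjTranspose_apply, U, of_apply, star_star, Pi.smul_apply, smul_eq_mul, mulVec,
    dotProduct, Pi.star_apply]
  ring

/-- Spectral expansion of a quadratic form. -/
theorem IsOrtho.quadratic {N : ℕ} {Φ : Fin N → Fin N → ℂ} (h : IsOrtho Φ)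
    {S : Matrix (Fin N) (Fin N) ℂ} {s : Fin N → ℝ} (hs : ∀ i, S *ᵥ Φ i = (s i : ℂ) • Φ i)
    (c : Fin N → ℂ) :
    ray S (∑ i, c i • Φ i) = ∑ i, ‖c i‖ ^ 2 * s i := by
  have h1 : S *ᵥ (∑ i, c i • Φ i) = ∑ i, (c i * s i) • Φ i := by
    rw [mulVec_sum]
    exact sum_congr rfl fun i _ => by rw [mulVec_smul, hs, smul_smul]
  rw [ray, h1, star_sum, sum_dotProduct, Complex.re_sum]
  refine sum_congr rfl fun i _ => ?_
  rw [star_smul, smul_dotProduct, h.dotProduct_combination, smul_eq_mul, Complex.star_def, ← mul_assoc,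
    ← Complex.normSq_eq_conj_mul_self, ← Complex.ofReal_mul, Complex.ofReal_re,
    Complex.normSq_eq_norm_sq]

theorem IsFrame.exists_ray_eq {N : ℕ} {S : Matrix (Fin N) (Fin N) ℂ} {Φ : Fin N → Fin N → ℂ}
    (h : IsFrame S Φ) {v : Fin N → ℂ} {θ : ℂ} (hv : S *ᵥ v = θ • v) (hv0 : v ≠ 0) :
    ∃ i, θ = ray S (Φ i) := by
  by_contra! hne
  apply hv0
  rw [h.ortho.expand v]
  refine sum_eq_zero fun i _ => ?_
  have h1 : S *ᵥ v = ∑ i, ((star (Φ i) ⬝ᵥ v) * ray S (Φ i)) • Φ i := by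
    conv_lhs => rw [h.ortho.expand v]
    rw [mulVec_sum]
    exact sum_congr rfl fun i _ => by rw [mulVec_smul, h.eigen, smul_smul]
  have h2 := h.ortho.dotProduct_combination (fun i => (star (Φ i) ⬝ᵥ v) * ray S (Φ i)) i
  rw [← h1, hv, dotProduct_smul, smul_eq_mul] at h2
  have h3 : (θ - ray S (Φ i)) * (star (Φ i) ⬝ᵥ v) = 0 := by linear_combination h2
  rw [(mul_eq_zero.1 h3).resolve_left (sub_ne_zero.2 (hne i)), zero_smul]

theorem star_dotProduct_self {ι : Type*} [Fintype ι] (v : ι → ℂ) :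
    star v ⬝ᵥ v = ((∑ i, ‖v i‖ ^ 2 : ℝ) : ℂ) := by
  rw [dotProduct, Complex.ofReal_sum]
  refine sum_congr rfl fun i _ => ?_
  rw [Pi.star_apply, Complex.star_def, ← Complex.normSq_eq_conj_mul_self,
    Complex.normSq_eq_norm_sq]

theorem orthogonal_ne {n : ℕ} {c b : ℤ → ℝ} (hb : Unreduced n b)
    {u v : Fin (n + 1) → ℂ} {θ : ℂ} (hu : triMat (n + 1) c b *ᵥ u = θ • u)
    (hv : triMat (n + 1) c b *ᵥ v = θ • v) (hu0 : u ≠ 0) (hv0 : v ≠ 0) : star u ⬝ᵥ v ≠ 0 := by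
  intro h0
  have p := eigen_proportional hb hu hv
  have h1 : star u ⬝ᵥ (v (Fin.last n) • u) = star u ⬝ᵥ (u (Fin.last n) • v) := by rw [p]
  rw [dotProduct_smul, dotProduct_smul, h0, smul_zero, smul_eq_mul, mul_eq_zero] at h1
  rcases h1 with h1 | h1
  · exact last_ne_zero hb hv hv0 h1
  · rw [star_dotProduct_self, Complex.ofReal_eq_zero,
      sum_eq_zero_iff_of_nonneg fun _ _ => by positivity] at h1
    exact hu0 (funext fun i => by simpa using h1 i (mem_univ i))

theorem IsFrame.strictAnti {n : ℕ} {c b : ℤ → ℝ} (hb : Unreduced n b)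
    {Φ : Fin (n + 1) → Fin (n + 1) → ℂ} (h : IsFrame (triMat (n + 1) c b) Φ) :
    StrictAnti fun i => ray (triMat (n + 1) c b) (Φ i) := by
  refine h.anti.strictAnti_of_injective fun i j hij => ?_
  by_contra hne
  have hj := h.eigen j
  change ray _ _ = ray _ _ at hij
  rw [← hij] at hj
  exact orthogonal_ne hb (h.eigen i) hj (h.ortho.ne_zero i) (h.ortho.ne_zero j)
    (by rw [h.ortho i j, if_neg hne])

theorem IsFrame.ray_unique {n : ℕ} {c b : ℤ → ℝ} (hb : Unreduced n b)
    {Φ Ψ : Fin (n + 1) → Fin (n + 1) → ℂ} (h : IsFrame (triMat (n + 1) c b) Φ)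
    (h' : IsFrame (triMat (n + 1) c b) Ψ) (i : Fin (n + 1)) :
    ray (triMat (n + 1) c b) (Φ i) = ray (triMat (n + 1) c b) (Ψ i) := by
  have key : (fun i => -ray (triMat (n + 1) c b) (Φ i)) =
      fun i => -ray (triMat (n + 1) c b) (Ψ i) := by
    refine (StrictMono.range_inj (fun _ _ hij => neg_lt_neg (h.strictAnti hb hij))
      (fun _ _ hij => neg_lt_neg (h'.strictAnti hb hij))).1 ?_
    have sub : ∀ {A B : Fin (n + 1) → Fin (n + 1) → ℂ}, IsFrame (triMat (n + 1) c b) A →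
        IsFrame (triMat (n + 1) c b) B → Set.range (fun i => -ray (triMat (n + 1) c b) (A i)) ⊆
        Set.range fun i => -ray (triMat (n + 1) c b) (B i) := by
      rintro A B hA hB _ ⟨i, rfl⟩
      obtain ⟨j, hj⟩ := hB.exists_ray_eq (hA.eigen i) (hA.ortho.ne_zero i)
      exact ⟨j, by simpa using (Complex.ofReal_injective hj).symm⟩
    exact (sub h h').antisymm (sub h' h)
  exact neg_injective (congrFun key i)

/-- The quadratic form of the Dirichlet kernel matrix. -/
noncomputable def energy (N M : ℕ) (α : ℝ) (v : Fin N → ℂ) : ℝ :=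
  ∑ l, ‖(trigMat N M α *ᵥ v) l‖ ^ 2

theorem energy_nonneg (N M : ℕ) (α : ℝ) (v : Fin N → ℂ) : 0 ≤ energy N M α v :=
  sum_nonneg fun _ _ => by positivity

theorem star_dotProduct_kerMat (N M : ℕ) (α : ℝ) (v : Fin N → ℂ) :
    star v ⬝ᵥ (kerMat N M α *ᵥ v) = (energy N M α v : ℂ) := by
  rw [energy, ← star_dotProduct_self, ← trigMat_conjTranspose_mul, ← mulVec_mulVec,
    dotProduct_mulVec, star_mulVec]

theorem energy_eq_ray (N M : ℕ) (α : ℝ) (v : Fin N → ℂ) :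
    energy N M α v = ray (kerMat N M α) v := by
  rw [ray, star_dotProduct_kerMat, Complex.ofReal_re]

theorem IsFrame.kerMat_eigen {n M : ℕ} {α : ℝ} (hb : Unreduced n (offCoeff (n + 1) α))
    {Φ : Fin (n + 1) → Fin (n + 1) → ℂ} (h : IsFrame (prolateMat (n + 1) M α) Φ)
    (i : Fin (n + 1)) :
    kerMat (n + 1) M α *ᵥ Φ i = (energy (n + 1) M α (Φ i) : ℂ) • Φ i := by
  obtain ⟨κ, hκ⟩ := exists_eigen_of_commute hb (prolateMat_commute (n + 1) M α) (h.eigen i)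
    (h.ortho.ne_zero i)
  rw [← star_dotProduct_kerMat, hκ, dotProduct_smul, h.ortho i i, if_pos rfl, smul_eq_mul, mul_one]

/-- Since the eigenspaces are lines, energies depend only on `α` and the index. The deformation
argument thus needs no continuous choice of eigenvectors. -/
theorem IsFrame.energy_unique {n M : ℕ} {α : ℝ} (hb : Unreduced n (offCoeff (n + 1) α))
    {Φ Ψ : Fin (n + 1) → Fin (n + 1) → ℂ} (h : IsFrame (prolateMat (n + 1) M α) Φ)
    (h' : IsFrame (prolateMat (n + 1) M α) Ψ) (i : Fin (n + 1)) :
    energy (n + 1) M α (Φ i) = energy (n + 1) M α (Ψ i) := by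
  have hi := h'.eigen i
  rw [← h.ray_unique hb h' i] at hi
  have := eigen_transfer hb (h.eigen i) hi (h.ortho.ne_zero i) (h.kerMat_eigen hb i)
  rw [energy_eq_ray _ _ _ (Ψ i), h'.ortho.ray_eq this]

theorem IsFrame.energy_sum {n M : ℕ} {α : ℝ} (hb : Unreduced n (offCoeff (n + 1) α))
    {Φ : Fin (n + 1) → Fin (n + 1) → ℂ} (h : IsFrame (prolateMat (n + 1) M α) Φ)
    (c : Fin (n + 1) → ℂ) :
    energy (n + 1) M α (∑ i, c i • Φ i) = ∑ i, ‖c i‖ ^ 2 * energy (n + 1) M α (Φ i) := by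
  rw [energy_eq_ray]
  exact h.ortho.quadratic (h.kerMat_eigen hb) c

theorem IsOrtho.norm_sum {N : ℕ} {Φ : Fin N → Fin N → ℂ} (h : IsOrtho Φ) (c : Fin N → ℂ) :
    ∑ x, ‖(∑ i, c i • Φ i) x‖ ^ 2 = ∑ i, ‖c i‖ ^ 2 := by
  have := h.quadratic (S := 1) (s := fun _ => 1) (fun i => by simp) c
  rw [ray, one_mulVec, star_dotProduct_self, Complex.ofReal_re] at this
  simpa using this

theorem unreduced_offCoeff {n : ℕ} {α : ℝ} (hα : 0 < α) (hN : (n : ℝ) * α < Real.pi) :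
    Unreduced n (offCoeff (n + 1) α) := by
  refine ⟨fun j h1 h2 => offCoeff_ne_zero_of_lt hα ?_ h1 (by omega), ?_⟩
  · push_cast; simpa using hN
  · have := offCoeff_self (n + 1) α
    push_cast at this; exact this

theorem IsFrame.energy_eq_zero_of_eq {n M : ℕ} {α : ℝ} (hα : 0 < α)
    (hN : (n : ℝ) * α < Real.pi) (hM : ((M : ℝ) + n - 1) * α < Real.pi)
    {Φ : Fin (n + 1) → Fin (n + 1) → ℂ} (h : IsFrame (prolateMat (n + 1) M α) Φ)
    {i j : Fin (n + 1)} (hij : i ≠ j)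
    (he : energy (n + 1) M α (Φ i) = energy (n + 1) M α (Φ j)) :
    energy (n + 1) M α (Φ i) = 0 := by
  by_contra hne
  have hb := unreduced_offCoeff hα hN
  have kj := h.kerMat_eigen hb j
  rw [← he] at kj
  have l (k : Fin (n + 1)) : zext (Φ k) n ≠ 0 := by
    rw [zext_natCast _ (Nat.lt_succ_self n)]
    exact last_ne_zero hb (h.eigen k) (h.ortho.ne_zero k)
  refine kernel_eigenvalue_ne hα hN hM (fun e => hij ((h.strictAnti hb).injective ?_))
    (Complex.ofReal_ne_zero.2 hne) (eigen_iff_triOp.1 (h.eigen i)) (eigen_iff_triOp.1 (h.eigen j))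
    (eigen_iff_kerConv.1 (h.kerMat_eigen hb i)) (eigen_iff_kerConv.1 kj) (l i) (l j)
  exact Complex.ofReal_injective e

theorem trigMat_mulVec (N M : ℕ) (α : ℝ) (v : Fin N → ℂ) (l : Fin M) :
    (trigMat N M α *ᵥ v) l = ∑ j : Fin N, (Complex.exp (((α * (1 - M) * j : ℝ) : ℂ) * Complex.I) *
      v j) * Complex.exp (((2 * α * j : ℝ) : ℂ) * Complex.I) ^ (l : ℕ) := by
  rw [mulVec, dotProduct]
  refine sum_congr rfl fun j _ => ?_
  rw [trigMat, of_apply, mul_right_comm, ← Complex.exp_nat_mul, ← Complex.exp_add]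
  congr 2
  simp only [freq]; push_cast; ring

/-- A vector supported on at most `M` positions is determined by its trigonometric sums. -/
theorem eq_zero_of_trigMat_mulVec {n M : ℕ} {α : ℝ} (hα : 0 < α) (hN : (n : ℝ) * α < Real.pi)
    {k : ℕ} (hk : k < M) {v : Fin (n + 1) → ℂ} (hv : ∀ x : Fin (n + 1), k < (x : ℕ) → v x = 0)
    (h : trigMat (n + 1) M α *ᵥ v = 0) (hkn : k ≤ n) : v = 0 := by
  -- Up to a common phase the nodes `exp(2iαx)` are the exponentials of `n + 1` symmetric
  -- frequencies, so the earlier injectivity applies.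
  have cast_inj : Function.Injective fun i : Fin (k + 1) =>
      Complex.exp (((2 * α * (i : ℕ) : ℝ) : ℂ) * Complex.I) := by
    intro i j hij
    have hM : (((n + 1 : ℕ) : ℝ) - 1) * α < Real.pi := by push_cast; simpa using hN
    have hf : ∀ i : ℕ, Complex.exp (((freq (n + 1) α i : ℝ) : ℂ) * Complex.I) =
        Complex.exp (((2 * α * i : ℝ) : ℂ) * Complex.I) *
          Complex.exp (((-(α * n) : ℝ) : ℂ) * Complex.I) := by
      intro i
      rw [← Complex.exp_add]; congr 1
      simp only [freq]; push_cast; ring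
    refine Fin.ext (exp_freq_injOn (M := n + 1) hα hM (by omega) (by omega) ?_)
    rw [hf, hf]
    change _ = _ at hij
    simp only at hij
    rw [hij]
  have z : (fun i : Fin (k + 1) => Complex.exp (((α * (1 - M) * (i : ℕ) : ℝ) : ℂ) * Complex.I) *
      v ⟨i, by omega⟩) = 0 := by
    -- Only the first `k + 1 ≤ M` sums are used, which makes the Vandermonde system square.
    refine Matrix.eq_zero_of_forall_pow_sum_mul_pow_eq_zero cast_inj fun l => ?_
    have h1 := congrFun h ⟨l, by omega⟩
    rw [trigMat_mulVec, Pi.zero_apply] at h1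
    rw [← h1]
    have e := Fin.sum_univ_eq_sum_range (fun x : ℕ =>
      (Complex.exp (((α * (1 - M) * x : ℝ) : ℂ) * Complex.I) * zext v x) *
        Complex.exp (((2 * α * x : ℝ) : ℂ) * Complex.I) ^ (l : ℕ))
    have e1 := e (k + 1)
    have e2 := e (n + 1)
    rw [← Finset.sum_subset (Finset.range_mono (show k + 1 ≤ n + 1 by omega)), ← e1] at e2
    · simp only [zext_fin] at e2
      rw [e2]
      refine sum_congr rfl fun i _ => ?_
      rw [zext_natCast v (show (i : ℕ) < n + 1 by omega)]
    · intro x hx hx'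
      rw [mem_range] at hx hx'
      rw [zext_natCast v hx, hv _ (by simp; omega)]
      simp
  ext x
  by_cases hx : k < (x : ℕ)
  · exact hv x hx
  · have := congrFun z ⟨x, by omega⟩
    simpa using this

theorem energy_eq_zero_iff {N M : ℕ} {α : ℝ} {v : Fin N → ℂ} :
    energy N M α v = 0 ↔ trigMat N M α *ᵥ v = 0 := by
  rw [energy, sum_eq_zero_iff_of_nonneg fun _ _ => by positivity]
  simp [funext_iff]

/-- Otherwise the `n + 1 - i` vectors from index `i` on span a space of zero energy. Imposing zeros
at the `n - i` positions beyond `i` leaves a nonzero vector supported on `i + 1 ≤ M` positions,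
contradicting the Vandermonde argument. -/
theorem IsFrame.exists_energy_ne_zero {n M : ℕ} {α : ℝ} (hα : 0 < α) (hN : (n : ℝ) * α < Real.pi)
    {Φ : Fin (n + 1) → Fin (n + 1) → ℂ} (h : IsFrame (prolateMat (n + 1) M α) Φ)
    {i : Fin (n + 1)} (hi : (i : ℕ) < M) : ∃ j, i ≤ j ∧ energy (n + 1) M α (Φ j) ≠ 0 := by
  by_contra! hz
  have hb := unreduced_offCoeff hα hN
  obtain ⟨c, hc0, hcs, hc⟩ := exists_ne_zero_supported (p := n - i) (Finset.Ici i)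
    (by rw [Fin.card_Ici]; omega)
    (fun k j => Φ j ⟨i + 1 + k, by omega⟩)
  have hE : energy (n + 1) M α (∑ j, c j • Φ j) = 0 := by
    rw [h.energy_sum hb]
    refine sum_eq_zero fun j _ => ?_
    by_cases hj : i ≤ j
    · rw [hz j hj, mul_zero]
    · rw [hcs j (by simpa using hj)]; simp
  have hψ := eq_zero_of_trigMat_mulVec hα hN hi (v := ∑ j, c j • Φ j) (fun x hx => by
    have := hc ⟨x - (i + 1), by omega⟩
    have e : (⟨(i : ℕ) + 1 + (x - (i + 1)), by omega⟩ : Fin (n + 1)) = x := Fin.ext (by simp; omega)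
    simp only [e] at this
    rw [Finset.sum_apply, ← this]
    exact sum_congr rfl fun j _ => by simp [mul_comm]) (energy_eq_zero_iff.1 hE) (by omega)
  apply hc0
  ext k
  rw [← h.ortho.dotProduct_combination c k, hψ]; simp

/-- The trigonometric system has only `M` rows, so more than `M` basis vectors have a nontrivial
combination of zero energy; the energy is diagonal in the basis. -/
theorem IsFrame.exists_energy_eq_zero {n M : ℕ} {α : ℝ} (hα : 0 < α) (hN : (n : ℝ) * α < Real.pi)
    {Φ : Fin (n + 1) → Fin (n + 1) → ℂ} (h : IsFrame (prolateMat (n + 1) M α) Φ)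
    (s : Finset (Fin (n + 1))) (hs : M < s.card) : ∃ j ∈ s, energy (n + 1) M α (Φ j) = 0 := by
  by_contra! hz
  have hb := unreduced_offCoeff hα hN
  obtain ⟨c, hc0, hcs, hc⟩ := exists_ne_zero_supported s hs
    (fun l j => (trigMat (n + 1) M α *ᵥ Φ j) l)
  have hE : energy (n + 1) M α (∑ j, c j • Φ j) = 0 := by
    rw [energy_eq_zero_iff]
    ext l
    rw [mulVec_sum, Finset.sum_apply, Pi.zero_apply, ← hc l]
    exact sum_congr rfl fun j _ => by rw [mulVec_smul]; simp [mul_comm]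
  rw [h.energy_sum hb, sum_eq_zero_iff_of_nonneg
    fun j _ => mul_nonneg (by positivity) (energy_nonneg _ _ _ _)] at hE
  apply hc0
  ext k
  by_cases hk : k ∈ s
  · have := hE k (mem_univ k)
    simpa [hz k hk] using this
  · exact hcs k hk

end PeriodicProlate

/-! ### The rescaled matrix and its limit at `α = 0` -/

namespace PeriodicProlate

open Finset Matrix

/-- The diagonal coefficients after removing the constant `-1` and dividing by `α²`. -/
noncomputable def scaledDiag (N M : ℕ) (α : ℝ) (x : ℤ) : ℝ :=
  ((2 * x + 1 - N + M) / 2) ^ 2 * Real.sinc (α * ((2 * x + 1 - N + M) / 2)) ^ 2 +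
  ((2 * x + 1 - N - M) / 2) ^ 2 * Real.sinc (α * ((2 * x + 1 - N - M) / 2)) ^ 2

/-- The off-diagonal coefficients divided by `α²`. -/
noncomputable def scaledOff (N : ℕ) (α : ℝ) (x : ℤ) : ℝ :=
  x * (N - x) * Real.sinc (α * x) * Real.sinc (α * (N - x))

theorem mul_sinc (y : ℝ) : y * Real.sinc y = Real.sin y := by
  by_cases h : y = 0
  · simp [h]
  · rw [Real.sinc_of_ne_zero h]; field_simp

theorem offCoeff_eq_scaled (N : ℕ) (α : ℝ) (x : ℤ) :
    offCoeff N α x = α ^ 2 * scaledOff N α x := by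
  rw [offCoeff, scaledOff, ← mul_sinc, ← mul_sinc]; ring

/-- This is `-cos(p + q) cos(p - q) = sin² p + sin² q - 1`. Writing the sines through `sinc` keeps
the quotient by `α²` continuous at `α = 0`. -/
theorem diagCoeff_eq_scaled (N M : ℕ) (α : ℝ) (x : ℤ) :
    diagCoeff N M α x = -1 + α ^ 2 * scaledDiag N M α x := by
  set p := α * ((2 * x + 1 - N + M) / 2) with hp
  set q := α * ((2 * x + 1 - N - M) / 2) with hq
  have h1 : α ^ 2 * scaledDiag N M α x = Real.sin p ^ 2 + Real.sin q ^ 2 := by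
    rw [scaledDiag, ← mul_sinc p, ← mul_sinc q, hp, hq]; ring
  rw [h1, diagCoeff, show α * (2 * x + 1 - N) = p + q by rw [hp, hq]; ring,
    show α * M = p - q by rw [hp, hq]; ring, Real.cos_add, Real.cos_sub]
  have e1 := Real.sin_sq_add_cos_sq p
  have e2 := Real.sin_sq_add_cos_sq q
  have e3 : Real.cos p ^ 2 = 1 - Real.sin p ^ 2 := by linarith
  have e4 : Real.cos q ^ 2 = 1 - Real.sin q ^ 2 := by linarith
  linear_combination (-(Real.cos q ^ 2)) * e3 + (Real.sin p ^ 2 - 1) * e4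

theorem prolateMat_eq_scaled (N M : ℕ) (α : ℝ) :
    prolateMat N M α =
      (-1 : Matrix (Fin N) (Fin N) ℂ) +
        ((α ^ 2 : ℝ) : ℂ) • triMat N (scaledDiag N M α) (scaledOff N α) := by
  ext i j
  simp only [triMat, of_apply, Matrix.add_apply, Matrix.neg_apply, Matrix.smul_apply,
    Matrix.one_apply, smul_eq_mul, diagCoeff_eq_scaled, offCoeff_eq_scaled]
  by_cases h : i = j
  · rw [if_pos (congrArg _ h), if_pos h, if_pos (congrArg _ h)]; push_cast; ring
  · have h' : ¬ (i : ℕ) = j := fun e => h (Fin.ext e)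
    rw [if_neg h', if_neg h, if_neg h']
    split_ifs <;> push_cast <;> ring

theorem IsFrame.scaled {N M : ℕ} {α : ℝ} (hα : 0 < α) {Φ : Fin N → Fin N → ℂ}
    (h : IsFrame (prolateMat N M α) Φ) :
    IsFrame (triMat N (scaledDiag N M α) (scaledOff N α)) Φ := by
  set S := triMat N (scaledDiag N M α) (scaledOff N α) with hS
  have hα2 : ((α ^ 2 : ℝ) : ℂ) ≠ 0 := by exact_mod_cast (pow_pos hα 2).ne'
  have key : ∀ i, S *ᵥ Φ i = (((ray (prolateMat N M α) (Φ i) + 1) / α ^ 2 : ℝ) : ℂ) • Φ i := by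
    intro i
    have h1 := h.eigen i
    nth_rewrite 1 [prolateMat_eq_scaled] at h1
    rw [← hS, add_mulVec, neg_mulVec, one_mulVec, smul_mulVec] at h1
    have h2 : ((α ^ 2 : ℝ) : ℂ) • (S *ᵥ Φ i) = ((ray (prolateMat N M α) (Φ i) + 1 : ℝ) : ℂ) • Φ i := by
      push_cast at h1 ⊢
      rw [add_smul, ← h1, one_smul]; abel
    refine smul_right_injective _ hα2 ?_
    change ((α ^ 2 : ℝ) : ℂ) • (S *ᵥ Φ i) = ((α ^ 2 : ℝ) : ℂ) • _
    rw [h2, smul_smul, ← Complex.ofReal_mul, mul_div_cancel₀ _ (pow_pos hα 2).ne']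
  have hr : ∀ i, ray S (Φ i) = (ray (prolateMat N M α) (Φ i) + 1) / α ^ 2 :=
    fun i => h.ortho.ray_eq (key i)
  refine ⟨h.ortho, fun i => by rw [key i, hr i], fun i j hij => ?_⟩
  simp only [hr]
  have := h.anti hij
  simp only at this
  gcongr

/-- Falling factorials as functions on the integers. -/
noncomputable def falling (r : ℕ) (x : ℤ) : ℂ := ∏ k ∈ range r, ((x : ℂ) - k)

theorem falling_succ (r : ℕ) (x : ℤ) : falling (r + 1) x = falling r x * (x - r) :=
  prod_range_succ _ _

theorem mul_falling_pred (r : ℕ) (x : ℤ) : (x : ℂ) * falling r (x - 1) = (x - r) * falling r x := by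
  induction r with
  | zero => simp [falling]
  | succ r ih =>
    rw [falling_succ, falling_succ]; push_cast
    linear_combination ((x : ℂ) - 1 - r) * ih

theorem falling_succ_add_one (r : ℕ) (x : ℤ) : falling (r + 1) (x + 1) = (x + 1) * falling r x := by
  have := mul_falling_pred r (x + 1)
  rw [show x + 1 - 1 = x by ring] at this
  push_cast at this
  rw [falling_succ, this]; push_cast; ring

/-- The eigenvalues of the limiting tridiagonal matrix. -/
noncomputable def limitEigenvalue (N M r : ℕ) : ℝ :=
  ((N : ℝ) ^ 2 + (M : ℝ) ^ 2 - 1) / 2 - r * (r + 1)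

theorem limitEigenvalue_strictAnti (N M : ℕ) : StrictAnti (limitEigenvalue N M) := by
  intro r s h
  have : (r : ℝ) < s := by exact_mod_cast h
  have h0 : (0 : ℝ) ≤ r := by positivity
  simp only [limitEigenvalue]
  nlinarith

/-- The limiting operator is triangular on falling factorials, so its eigenvalues are the diagonal
coefficients. For `r = 0` the truncated index `r - 1` is harmless because of the factor `r ^ 2`. -/
theorem triOp_falling (N M r : ℕ) (x : ℤ) :
    triOp (scaledDiag N M 0) (scaledOff N 0) (falling r) x =
      limitEigenvalue N M r * falling r x + (r : ℂ) ^ 2 * (N - r) * falling (r - 1) x := by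
  have hc : scaledDiag N M 0 x = ((2 * x + 1 - N) ^ 2 + (M : ℝ) ^ 2) / 2 := by
    simp only [scaledDiag, zero_mul, Real.sinc_zero]; ring
  have hb : ∀ y : ℤ, scaledOff N 0 y = y * (N - y) := by
    intro y; simp [scaledOff]
  rw [triOp, hc, hb, hb, limitEigenvalue]
  rcases r with _ | s
  · simp only [falling, range_zero, prod_empty]
    push_cast; ring
  · have h1 := mul_falling_pred (s + 1) x
    have h2 := falling_succ_add_one s x
    rw [h2]
    rw [falling_succ s x] at h1 ⊢
    simp only [Nat.add_sub_cancel]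
    push_cast at h1 ⊢
    linear_combination ((N : ℂ) - x) * h1

/-- Factorial moments of a vector. -/
noncomputable def fallingMoment {N : ℕ} (v : Fin N → ℂ) (r : ℕ) : ℂ :=
  ∑ x : Fin N, v x * falling r (x : ℕ)

theorem triMat_transpose (N : ℕ) (c b : ℤ → ℝ) : (triMat N c b)ᵀ = triMat N c b := by
  ext i j
  simp only [transpose_apply, triMat, of_apply]
  rcases lt_trichotomy (i : ℕ) j with h | h | h
  · simp only [show ¬ (j : ℕ) = i by omega, show ¬ (i : ℕ) = j by omega,
      show ¬ (j : ℕ) + 1 = i by omega, if_false]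
  · have : i = j := Fin.ext h
    subst this; rfl
  · simp only [show ¬ (j : ℕ) = i by omega, show ¬ (i : ℕ) = j by omega,
      show ¬ (i : ℕ) + 1 = j by omega, if_false]

theorem scaledOff_zero (N : ℕ) (α : ℝ) : scaledOff N α 0 = 0 := by simp [scaledOff]

theorem scaledOff_self (N : ℕ) (α : ℝ) : scaledOff N α N = 0 := by simp [scaledOff]

/-- The matrix is symmetric, so it can be moved from the eigenvector to the falling factorial. -/
theorem fallingMoment_recurrence {N M : ℕ} {v : Fin N → ℂ} {τ : ℂ}
    (h : triMat N (scaledDiag N M 0) (scaledOff N 0) *ᵥ v = τ • v) (r : ℕ) :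
    τ * fallingMoment v r = limitEigenvalue N M r * fallingMoment v r +
      (r : ℂ) ^ 2 * (N - r) * fallingMoment v (r - 1) := by
  set S := triMat N (scaledDiag N M 0) (scaledOff N 0) with hS
  let f : Fin N → ℂ := fun x => falling r (x : ℕ)
  have h1 : f ⬝ᵥ (S *ᵥ v) = (S *ᵥ f) ⬝ᵥ v := by
    rw [dotProduct_mulVec, ← mulVec_transpose, hS, triMat_transpose]
  have h2 : ∀ x : Fin N, (S *ᵥ f) x = limitEigenvalue N M r * falling r (x : ℕ) +
      (r : ℂ) ^ 2 * (N - r) * falling (r - 1) (x : ℕ) := by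
    intro x
    rw [hS, triMat_mulVec, triOp_congr (scaledOff_zero N 0) (scaledOff_self N 0)
      (v := falling r) (fun j hj => zext_natCast f hj) x.2, triOp_falling]
  rw [h, dotProduct_smul, smul_eq_mul, dotProduct_comm] at h1
  simp only [fallingMoment, mul_sum]
  rw [dotProduct, mul_sum] at h1
  rw [h1, dotProduct, ← sum_add_distrib]
  exact sum_congr rfl fun x _ => by rw [h2]; ring

theorem falling_eq_zero {r x : ℕ} (h : x < r) : falling r x = 0 :=
  prod_eq_zero (mem_range.2 h) (by simp)

theorem falling_self_ne_zero (r : ℕ) : falling r r ≠ 0 := by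
  refine prod_ne_zero_iff.2 fun k hk => ?_
  rw [mem_range] at hk
  rw [sub_ne_zero]
  exact_mod_cast hk.ne'

theorem exists_fallingMoment_ne_zero {N : ℕ} {v : Fin N → ℂ} (hv : v ≠ 0) :
    ∃ r < N, fallingMoment v r ≠ 0 := by
  by_contra! h
  apply hv
  -- Entries are killed from the last one down: the moment of order `x` ignores positions below `x`,
  -- and those above are already zero.
  have key : ∀ k : ℕ, ∀ x : Fin N, (x : ℕ) + k + 1 = N → v x = 0 := by
    intro k
    induction k using Nat.strong_induction_on with
    | _ k ih =>
      intro x hx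
      have hm := h x x.2
      rw [fallingMoment, sum_eq_single x] at hm
      · exact (mul_eq_zero.1 hm).resolve_right (falling_self_ne_zero x)
      · intro y _ hy
        rcases lt_or_gt_of_ne hy with h' | h'
        · rw [falling_eq_zero (Fin.lt_def.1 h'), mul_zero]
        · have h'' := Fin.lt_def.1 h'
          rw [ih (N - 1 - y) (by omega) y (by omega), zero_mul]
      · intro hx; exact absurd (mem_univ x) hx
  ext x
  exact key (N - 1 - x) x (by omega)

/-- At the lowest nonvanishing moment the lower-order term of the recurrence drops out, which
identifies the eigenvalue. -/
theorem exists_limitEigenvalue_eq {N M : ℕ} {v : Fin N → ℂ} {τ : ℂ} (hv : v ≠ 0)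
    (h : triMat N (scaledDiag N M 0) (scaledOff N 0) *ᵥ v = τ • v) :
    ∃ r : Fin N, τ = limitEigenvalue N M r ∧ fallingMoment v r ≠ 0 ∧
      ∀ s < (r : ℕ), fallingMoment v s = 0 := by
  classical
  obtain ⟨r₀, hr₀, hr₀'⟩ := exists_fallingMoment_ne_zero hv
  have ex : ∃ r, fallingMoment v r ≠ 0 := ⟨r₀, hr₀'⟩
  refine ⟨⟨Nat.find ex, (Nat.find_min' ex hr₀').trans_lt hr₀⟩, ?_, Nat.find_spec ex,
    fun s hs => not_not.1 (Nat.find_min ex hs)⟩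
  have hrec := fallingMoment_recurrence h (Nat.find ex)
  have z : (((Nat.find ex : ℕ) : ℂ)) ^ 2 * (N - (Nat.find ex : ℕ)) *
      fallingMoment v (Nat.find ex - 1) = 0 := by
    rcases Nat.eq_zero_or_pos (Nat.find ex) with h0 | h0
    · rw [h0]; simp
    · rw [not_not.1 (Nat.find_min ex (m := Nat.find ex - 1) (by omega)), mul_zero]
  rw [z, add_zero] at hrec
  exact mul_right_cancel₀ (Nat.find_spec ex) hrec

theorem unreduced_scaledOff (n : ℕ) : Unreduced n (scaledOff (n + 1) 0) := by
  constructor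
  · intro j h1 h2
    have h3 : (1 : ℝ) ≤ j := by exact_mod_cast h1
    have h4 : (j : ℝ) ≤ n := by exact_mod_cast h2
    simp only [scaledOff, zero_mul, Real.sinc_zero, mul_one]
    refine mul_ne_zero ?_ ?_ <;> push_cast <;> linarith
  · have := scaledOff_self (n + 1) 0
    push_cast at this; exact this

theorem IsFrame.fallingMoment_limit {n M : ℕ} {Φ : Fin (n + 1) → Fin (n + 1) → ℂ}
    (h : IsFrame (triMat (n + 1) (scaledDiag (n + 1) M 0) (scaledOff (n + 1) 0)) Φ)
    (i : Fin (n + 1)) :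
    fallingMoment (Φ i) i ≠ 0 ∧ ∀ s < (i : ℕ), fallingMoment (Φ i) s = 0 := by
  choose r hr hne hz using fun i => exists_limitEigenvalue_eq (h.ortho.ne_zero i) (h.eigen i)
  have mono : StrictMono r := by
    intro i j hij
    have := h.strictAnti (unreduced_scaledOff n) hij
    simp only at this
    rw [Complex.ofReal_injective (hr i), Complex.ofReal_injective (hr j)] at this
    exact Fin.lt_def.2 ((limitEigenvalue_strictAnti _ _).lt_iff_gt.1 this)
  -- Sorting makes the order of the lowest moment strictly increasing in the index, and a strictly
  -- increasing self-map of a finite chain is the identity.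
  have hid : r = id := (StrictMono.range_inj mono strictMono_id).1 (by
    rw [Set.range_id, (Finite.injective_iff_surjective.1 mono.injective).range_eq])
  have := congrFun hid i
  rw [id] at this
  have h1 := hne i
  have h2 := hz i
  rw [this] at h1 h2
  exact ⟨h1, h2⟩

/-- Powers and falling factorials of equal degree differ by lower-order terms, whose moments vanish.
-/
theorem sum_pow_eq_fallingMoment {N : ℕ} {v : Fin N → ℂ} {i : ℕ}
    (hz : ∀ s < i, fallingMoment v s = 0) :
    ∑ x : Fin N, v x * ((x : ℕ) : ℂ) ^ i = fallingMoment v i := by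
  have key : ∀ s r : ℕ, s + r ≤ i →
      ∑ x : Fin N, v x * (((x : ℕ) : ℂ) ^ s * falling r (x : ℕ)) = fallingMoment v (s + r) := by
    intro s
    induction s with
    | zero => intro r _; simp [fallingMoment]
    | succ s ih =>
      intro r hr
      have h1 := ih (r + 1) (by omega)
      have h2 := ih r (by omega)
      rw [hz (s + r) (by omega)] at h2
      rw [show s + 1 + r = s + (r + 1) by omega, ← h1, ← sub_eq_zero, ← sum_sub_distrib,
        ← mul_zero (r : ℂ), ← h2, mul_sum]
      refine sum_congr rfl fun x _ => ?_
      rw [falling_succ]; push_cast; ring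
  have := key i 0 (by omega)
  simpa [falling] using this

end PeriodicProlate

/-! ### Energy bounds through moments -/

namespace PeriodicProlate

open Finset Matrix

/-- The modulated sample weight `exp(iα(1-M)x)`. -/
noncomputable def phase (M : ℕ) (α : ℝ) (x : ℕ) : ℂ :=
  Complex.exp (((α * (1 - M) * x : ℝ) : ℂ) * Complex.I)

/-- The node `exp(2iαx)`. -/
noncomputable def node (α : ℝ) (x : ℕ) : ℂ :=
  Complex.exp (((2 * α * x : ℝ) : ℂ) * Complex.I)

/-- The divided difference `(exp(2iαx) - 1)/α`, extended continuously to `α = 0`. -/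
noncomputable def nodeSlope (α : ℝ) (x : ℕ) : ℂ :=
  Complex.exp (((α * x : ℝ) : ℂ) * Complex.I) * (2 * Complex.I * x * (Real.sinc (α * x) : ℂ))

/-- Moments of a vector with respect to powers of `nodeSlope`. -/
noncomputable def slopeMoment {N : ℕ} (M : ℕ) (α : ℝ) (v : Fin N → ℂ) (r : ℕ) : ℂ :=
  ∑ x : Fin N, v x * (phase M α x * nodeSlope α x ^ r)

theorem node_sub_one (α : ℝ) (x : ℕ) : node α x - 1 = α * nodeSlope α x := by
  have h := mul_sinc (α * x)
  have h' : (α : ℂ) * x * (Real.sinc (α * x) : ℂ) = Complex.sin ((α * x : ℝ) : ℂ) := by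
    rw [← Complex.ofReal_sin, ← h]; push_cast; ring
  rw [nodeSlope, show (α : ℂ) * (Complex.exp (((α * x : ℝ) : ℂ) * Complex.I) *
    (2 * Complex.I * x * (Real.sinc (α * x) : ℂ))) =
    Complex.exp (((α * x : ℝ) : ℂ) * Complex.I) * (2 * Complex.I) *
      ((α : ℂ) * x * (Real.sinc (α * x) : ℂ)) by ring, h', Complex.sin, node,
    show ((2 * α * x : ℝ) : ℂ) * Complex.I =
      ((α * x : ℝ) : ℂ) * Complex.I + ((α * x : ℝ) : ℂ) * Complex.I by push_cast; ring,
    Complex.exp_add, neg_mul, Complex.exp_neg]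
  have := Complex.exp_ne_zero (((α * x : ℝ) : ℂ) * Complex.I)
  field_simp
  rw [Complex.I_sq]; ring

theorem norm_phase (M : ℕ) (α : ℝ) (x : ℕ) : ‖phase M α x‖ = 1 :=
  Complex.norm_exp_ofReal_mul_I _

theorem norm_nodeSlope_le (α : ℝ) (x : ℕ) : ‖nodeSlope α x‖ ≤ 2 * x := by
  rw [nodeSlope, norm_mul, Complex.norm_exp_ofReal_mul_I, one_mul, norm_mul, norm_mul, norm_mul,
    Complex.norm_I, Complex.norm_natCast, Complex.norm_real, Complex.norm_ofNat, Real.norm_eq_abs]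
  have := Real.abs_sinc_le_one (α * x)
  have h0 : (0 : ℝ) ≤ x := by positivity
  nlinarith

theorem sum_sub_one_pow {N : ℕ} (M : ℕ) (α : ℝ) (v : Fin N → ℂ) (r : ℕ) :
    ∑ x : Fin N, v x * (phase M α x * (node α x - 1) ^ r) = α ^ r * slopeMoment M α v r := by
  rw [slopeMoment, mul_sum]
  exact sum_congr rfl fun x _ => by rw [node_sub_one, mul_pow]; ring

theorem trigMat_mulVec_eq_node {N M : ℕ} (α : ℝ) (v : Fin N → ℂ) (l : Fin M) :
    (trigMat N M α *ᵥ v) l = ∑ x : Fin N, v x * (phase M α x * node α x ^ (l : ℕ)) := by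
  rw [trigMat_mulVec]
  exact sum_congr rfl fun x _ => by rw [phase, node]; ring

theorem norm_trigMat_mulVec_le {N M : ℕ} (α : ℝ) (v : Fin N → ℂ) (l : Fin M) :
    ‖(trigMat N M α *ᵥ v) l‖ ≤ √(energy N M α v) := by
  refine Real.le_sqrt_of_sq_le ?_
  exact single_le_sum (f := fun l => ‖(trigMat N M α *ᵥ v) l‖ ^ 2)
    (fun _ _ => by positivity) (mem_univ l)

/-- The `r`-th slope moment is controlled by the energy. -/
theorem slopeMoment_le {N M : ℕ} {α : ℝ} (hα : 0 < α) (v : Fin N → ℂ) {r : ℕ} (hr : r < M) :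
    α ^ r * ‖slopeMoment M α v r‖ ≤ 2 ^ r * √(energy N M α v) := by
  -- The binomial expansion of `(node - 1) ^ r` involves only the powers up to `r < M`, each of them
  -- a row of the trigonometric system.
  have h1 : (α : ℂ) ^ r * slopeMoment M α v r = ∑ l ∈ range (r + 1),
      (∑ x : Fin N, v x * (phase M α x * node α x ^ l)) * ((-1) ^ (r - l) * (r.choose l : ℂ)) := by
    rw [← sum_sub_one_pow]
    simp only [sum_mul]
    rw [sum_comm]
    refine sum_congr rfl fun x _ => ?_
    rw [sub_eq_add_neg, add_pow, mul_sum, mul_sum]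
    exact sum_congr rfl fun l _ => by ring
  have h2 : α ^ r * ‖slopeMoment M α v r‖ = ‖(α : ℂ) ^ r * slopeMoment M α v r‖ := by
    rw [norm_mul, norm_pow, Complex.norm_real, Real.norm_of_nonneg hα.le]
  rw [h2, h1]
  refine (norm_sum_le _ _).trans ?_
  have h3 : ∀ l ∈ range (r + 1), ‖(∑ x : Fin N, v x * (phase M α x * node α x ^ l)) *
      ((-1) ^ (r - l) * (r.choose l : ℂ))‖ ≤ √(energy N M α v) * r.choose l := by
    intro l hl
    rw [mem_range] at hl
    rw [norm_mul, norm_mul, norm_pow, norm_neg, norm_one, one_pow, one_mul, Complex.norm_natCast]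
    gcongr
    have := norm_trigMat_mulVec_le α v (⟨l, by omega⟩ : Fin M)
    rwa [trigMat_mulVec_eq_node] at this
  refine (sum_le_sum h3).trans ?_
  rw [← mul_sum, mul_comm]
  gcongr
  have := Nat.sum_range_choose r
  exact_mod_cast this.le

theorem norm_slopeMoment_le {N M : ℕ} (α : ℝ) (v : Fin N → ℂ) {r : ℕ} (hr : r ≤ M) :
    ‖slopeMoment M α v r‖ ≤ (2 * N + 1) ^ M * ∑ x, ‖v x‖ := by
  rw [slopeMoment, mul_sum]
  refine (norm_sum_le _ _).trans (sum_le_sum fun x _ => ?_)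
  rw [norm_mul, norm_mul, norm_phase, one_mul, norm_pow, mul_comm]
  gcongr
  have h1 : (x : ℝ) ≤ N := by exact_mod_cast x.2.le
  calc ‖nodeSlope α x‖ ^ r ≤ (2 * N + 1) ^ r := by
        gcongr
        exact (norm_nodeSlope_le α x).trans (by linarith)
    _ ≤ (2 * N + 1) ^ M := by
        gcongr
        have : (0 : ℝ) ≤ N := by positivity
        linarith

/-- A vector whose first slope moments vanish has small energy. -/
theorem energy_le_of_slopeMoment_eq_zero {N M : ℕ} {α : ℝ} (hα : 0 < α) (hα1 : α ≤ 1)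
    {v : Fin N → ℂ} {k : ℕ} (hz : ∀ r < k, slopeMoment M α v r = 0) :
    energy N M α v ≤
      (M * (2 ^ M * (2 * N + 1) ^ M) ^ 2 * N) * α ^ (2 * k) * ∑ x, ‖v x‖ ^ 2 := by
  set s := ∑ x, ‖v x‖ with hs
  have hs0 : 0 ≤ s := sum_nonneg fun _ _ => norm_nonneg _
  have hl : ∀ l : Fin M, ‖(trigMat N M α *ᵥ v) l‖ ≤ 2 ^ M * (2 * N + 1) ^ M * α ^ k * s := by
    intro l
    -- The inverse expansion, `node = (node - 1) + 1`, writes each row in terms of slope moments; a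
    -- moment of order `r` carries the factor `α ^ r`.
    have h1 : (trigMat N M α *ᵥ v) l = ∑ r ∈ range ((l : ℕ) + 1),
        ((α : ℂ) ^ r * slopeMoment M α v r) * ((l : ℕ).choose r : ℂ) := by
      simp only [← sum_sub_one_pow, sum_mul]
      rw [trigMat_mulVec_eq_node, sum_comm]
      refine sum_congr rfl fun x _ => ?_
      conv_lhs => rw [show node α x = (node α x - 1) + 1 by ring, add_pow, mul_sum, mul_sum]
      exact sum_congr rfl fun r _ => by rw [one_pow]; ring
    rw [h1]
    refine (norm_sum_le _ _).trans ?_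
    have h2 : ∀ r ∈ range ((l : ℕ) + 1),
        ‖((α : ℂ) ^ r * slopeMoment M α v r) * ((l : ℕ).choose r : ℂ)‖ ≤
          ((2 * N + 1) ^ M * α ^ k * s) * ((l : ℕ).choose r : ℝ) := by
      intro r hr
      rw [mem_range] at hr
      rw [norm_mul, Complex.norm_natCast]
      gcongr
      rcases lt_or_ge r k with h | h
      · rw [hz r h, mul_zero, norm_zero]; positivity
      · rw [norm_mul, norm_pow, Complex.norm_real, Real.norm_of_nonneg hα.le]
        calc α ^ r * ‖slopeMoment M α v r‖ ≤ α ^ k * ((2 * N + 1) ^ M * s) := by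
              exact mul_le_mul (pow_le_pow_of_le_one hα.le hα1 h)
                (norm_slopeMoment_le α v (by omega)) (norm_nonneg _) (by positivity)
          _ = _ := by ring
    refine (sum_le_sum h2).trans ?_
    rw [← mul_sum]
    have h3 : ∑ r ∈ range ((l : ℕ) + 1), ((l : ℕ).choose r : ℝ) ≤ 2 ^ M := by
      have := Nat.sum_range_choose (l : ℕ)
      have h4 : ∑ r ∈ range ((l : ℕ) + 1), ((l : ℕ).choose r : ℝ) = 2 ^ (l : ℕ) := by
        exact_mod_cast this
      rw [h4]
      exact pow_le_pow_right₀ one_le_two l.2.le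
    calc _ ≤ ((2 * N + 1) ^ M * α ^ k * s) * 2 ^ M := by gcongr
      _ = _ := by ring
  have hcs : s ^ 2 ≤ N * ∑ x, ‖v x‖ ^ 2 := by
    have := sq_sum_le_card_mul_sum_sq (s := (univ : Finset (Fin N))) (f := fun x => ‖v x‖)
    simpa using this
  calc energy N M α v ≤ ∑ _l : Fin M, (2 ^ M * (2 * N + 1) ^ M * α ^ k * s) ^ 2 :=
        sum_le_sum fun l _ => by gcongr; exact hl l
    _ = M * (2 ^ M * (2 * N + 1) ^ M) ^ 2 * α ^ (2 * k) * s ^ 2 := by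
        rw [sum_const, card_univ, Fintype.card_fin, nsmul_eq_mul]; ring
    _ ≤ M * (2 ^ M * (2 * N + 1) ^ M) ^ 2 * α ^ (2 * k) * (N * ∑ x, ‖v x‖ ^ 2) := by
        gcongr
    _ = _ := by ring

theorem slopeMoment_zero {N : ℕ} (M : ℕ) (v : Fin N → ℂ) (r : ℕ) :
    slopeMoment M 0 v r = (2 * Complex.I) ^ r * ∑ x : Fin N, v x * ((x : ℕ) : ℂ) ^ r := by
  rw [slopeMoment, mul_sum]
  refine sum_congr rfl fun x _ => ?_
  simp only [phase, nodeSlope, zero_mul, Complex.ofReal_zero, Complex.exp_zero, Real.sinc_zero,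
    Complex.ofReal_one, mul_one, one_mul, mul_pow]
  ring

end PeriodicProlate

/-! ### Deformation in `α`: ordering of the energies -/

namespace PeriodicProlate

open Finset Matrix Filter Topology

theorem isHermitian_triMat (N : ℕ) (c b : ℤ → ℝ) : (triMat N c b).IsHermitian := by
  have h : (triMat N c b)ᴴ = (triMat N c b)ᵀ := by
    ext i j
    simp [triMat]
  rw [IsHermitian, h, triMat_transpose]

theorem IsOrtho.of_orthonormal {N : ℕ}
    {φ : Fin N → EuclideanSpace ℂ (Fin N)} (h : Orthonormal ℂ φ) :
    IsOrtho fun i => (φ i).ofLp := by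
  intro i j
  have h1 := (orthonormal_iff_ite.1 h) i j
  rw [EuclideanSpace.inner_eq_star_dotProduct, dotProduct_comm] at h1
  exact h1

theorem exists_isFrame {N : ℕ} {S : Matrix (Fin N) (Fin N) ℂ} (hS : S.IsHermitian) :
    ∃ Φ, IsFrame S Φ := by
  have hsym := isSymmetric_toEuclideanLin_iff.mpr hS
  have hn : Module.finrank ℂ (EuclideanSpace ℂ (Fin N)) = N := by simp
  let φ := hsym.eigenvectorBasis hn
  have ho : IsOrtho fun i => (φ i).ofLp := IsOrtho.of_orthonormal φ.orthonormal
  have he : ∀ i, S *ᵥ (φ i).ofLp = (hsym.eigenvalues hn i : ℂ) • (φ i).ofLp := by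
    intro i
    have := hsym.apply_eigenvectorBasis hn i
    exact congrArg WithLp.ofLp this
  have hr := fun i => ho.ray_eq (he i)
  refine ⟨fun i => (φ i).ofLp, ho, fun i => by rw [hr i, he i], fun i j hij => ?_⟩
  simp only [hr]
  exact hsym.eigenvalues_antitone hn hij

theorem IsOrtho.norm_le_one {N : ℕ} {Φ : Fin N → Fin N → ℂ} (h : IsOrtho Φ) (i x : Fin N) :
    ‖Φ i x‖ ≤ 1 := by
  have h1 := h i i
  rw [star_dotProduct_self, if_pos rfl] at h1
  have h2 : ∑ x, ‖Φ i x‖ ^ 2 = 1 := by exact_mod_cast h1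
  have h3 : ‖Φ i x‖ ^ 2 ≤ 1 := by
    rw [← h2]
    exact single_le_sum (f := fun x => ‖Φ i x‖ ^ 2) (fun _ _ => by positivity) (mem_univ x)
  exact (sq_le_one_iff₀ (norm_nonneg _)).1 h3

theorem isCompact_isOrtho (N : ℕ) : IsCompact {Φ : Fin N → Fin N → ℂ | IsOrtho Φ} := by
  refine Metric.isCompact_of_isClosed_isBounded ?_ ?_
  · simp only [IsOrtho, Set.ofPred_forall]
    refine isClosed_iInter fun i => isClosed_iInter fun j => isClosed_eq ?_ continuous_const
    simp only [dotProduct, Pi.star_apply]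
    fun_prop
  · refine (Metric.isBounded_closedBall (x := 0) (r := 1)).subset fun Φ hΦ => ?_
    rw [mem_closedBall_zero_iff, pi_norm_le_iff_of_nonneg zero_le_one]
    intro i
    rw [pi_norm_le_iff_of_nonneg zero_le_one]
    exact fun x => hΦ.norm_le_one i x

theorem continuous_ray {N : ℕ} {S : ℝ → Matrix (Fin N) (Fin N) ℂ} (hS : Continuous S)
    (i : Fin N) : Continuous fun p : ℝ × (Fin N → Fin N → ℂ) => ray (S p.1) (p.2 i) := by
  have hv : Continuous fun p : ℝ × (Fin N → Fin N → ℂ) => p.2 i :=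
    (continuous_apply i).comp continuous_snd
  exact Complex.continuous_re.comp
    (hv.star.dotProduct ((hS.comp continuous_fst).matrix_mulVec hv))

theorem isClosed_isFrame {N : ℕ} {S : ℝ → Matrix (Fin N) (Fin N) ℂ} (hS : Continuous S) :
    IsClosed {p : ℝ × (Fin N → Fin N → ℂ) | IsFrame (S p.1) p.2} := by
  have e : {p : ℝ × (Fin N → Fin N → ℂ) | IsFrame (S p.1) p.2} =
      {p | IsOrtho p.2} ∩ ({p | ∀ i x, (S p.1 *ᵥ p.2 i) x = (ray (S p.1) (p.2 i) : ℂ) * p.2 i x} ∩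
        {p | ∀ i j, i ≤ j → ray (S p.1) (p.2 j) ≤ ray (S p.1) (p.2 i)}) := by
    ext p
    constructor
    · intro h
      exact ⟨h.ortho, fun i x => by rw [h.eigen i]; rfl, fun i j hij => h.anti hij⟩
    · rintro ⟨h1, h2, h3⟩
      exact ⟨h1, fun i => funext fun x => h2 i x, fun i j hij => h3 i j hij⟩
  have hv (i : Fin N) : Continuous fun p : ℝ × (Fin N → Fin N → ℂ) => p.2 i :=
    (continuous_apply i).comp continuous_snd
  have hr := fun i => continuous_ray hS i
  rw [e]
  refine ((isCompact_isOrtho N).isClosed.preimage continuous_snd).inter (IsClosed.inter ?_ ?_)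
  · simp only [Set.ofPred_forall]
    refine isClosed_iInter fun i => isClosed_iInter fun x => isClosed_eq ?_ ?_
    · exact (continuous_apply x).comp ((hS.comp continuous_fst).matrix_mulVec (hv i))
    · exact (Complex.continuous_ofReal.comp (hr i)).mul ((continuous_apply x).comp (hv i))
  · simp only [Set.ofPred_forall]
    exact isClosed_iInter fun i => isClosed_iInter fun j => isClosed_iInter fun _ =>
      isClosed_le (hr j) (hr i)

theorem isCompact_isFrame {N : ℕ} {S : ℝ → Matrix (Fin N) (Fin N) ℂ} (hS : Continuous S)
    (a b : ℝ) :
    IsCompact {p : ℝ × (Fin N → Fin N → ℂ) | p.1 ∈ Set.Icc a b ∧ IsFrame (S p.1) p.2} := by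
  refine ((isCompact_Icc (a := a) (b := b)).prod (isCompact_isOrtho N)).of_isClosed_subset
    ((isClosed_Icc.preimage continuous_fst).inter (isClosed_isFrame hS)) ?_
  exact fun p hp => ⟨hp.1, hp.2.ortho⟩

theorem continuous_triMat {N : ℕ} {c b : ℝ → ℤ → ℝ} (hc : ∀ x, Continuous fun α => c α x)
    (hb : ∀ x, Continuous fun α => b α x) : Continuous fun α => triMat N (c α) (b α) := by
  refine continuous_matrix fun i j => ?_
  simp only [triMat, of_apply]
  refine Complex.continuous_ofReal.comp ?_
  split_ifs
  exacts [hc _, hb _, hb _, continuous_const]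

theorem continuous_prolateMat (N M : ℕ) : Continuous (prolateMat N M) :=
  continuous_triMat (fun x => by simp only [diagCoeff]; fun_prop)
    (fun x => by simp only [offCoeff]; fun_prop)

theorem continuous_scaled (N M : ℕ) :
    Continuous fun α => triMat N (scaledDiag N M α) (scaledOff N α) := by
  have := Real.continuous_sinc
  exact continuous_triMat (fun x => by simp only [scaledDiag]; fun_prop)
    (fun x => by simp only [scaledOff]; fun_prop)

theorem continuous_energy (N M : ℕ) (i : Fin N) :
    Continuous fun p : ℝ × (Fin N → Fin N → ℂ) => energy N M p.1 (p.2 i) := by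
  simp only [energy, mulVec, dotProduct, trigMat, of_apply, freq]
  fun_prop

theorem continuous_slopeMoment (N M r : ℕ) (i : Fin N) :
    Continuous fun p : ℝ × (Fin N → Fin N → ℂ) => slopeMoment M p.1 (p.2 i) r := by
  have := Real.continuous_sinc
  simp only [slopeMoment, phase, nodeSlope]
  fun_prop

/-- Near `α = 0` the `i`-th slope moment of the `i`-th frame vector stays away from zero. -/
theorem exists_slopeMoment_lower_bound (n M : ℕ) (i : Fin (n + 1)) :
    ∃ ε > 0, ∀ α ∈ Set.Icc (0 : ℝ) 1, ∀ Φ : Fin (n + 1) → Fin (n + 1) → ℂ,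
      IsFrame (triMat (n + 1) (scaledDiag (n + 1) M α) (scaledOff (n + 1) α)) Φ →
        ε ≤ α + ‖slopeMoment M α (Φ i) i‖ := by
  -- Adding `α` makes the function positive for `α > 0` trivially, so the moment itself has to be
  -- examined only at `α = 0`.
  have hc : Continuous fun p : ℝ × (Fin (n + 1) → Fin (n + 1) → ℂ) =>
      p.1 + ‖slopeMoment M p.1 (p.2 i) i‖ :=
    continuous_fst.add (continuous_slopeMoment (n + 1) M i i).norm
  obtain ⟨ε, hε, h⟩ := (isCompact_isFrame (continuous_scaled (n + 1) M) 0 1).exists_forall_le'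
    hc.continuousOn (a := 0) (by
      rintro ⟨α, Φ⟩ ⟨⟨h0, h1⟩, hΦ⟩
      simp only at h0 h1 hΦ ⊢
      rcases h0.eq_or_lt with h0 | h0
      · subst h0
        have hm := hΦ.fallingMoment_limit i
        have : slopeMoment M 0 (Φ i) i ≠ 0 := by
          rw [slopeMoment_zero, sum_pow_eq_fallingMoment hm.2]
          exact mul_ne_zero (pow_ne_zero _ (mul_ne_zero two_ne_zero Complex.I_ne_zero)) hm.1
        rw [zero_add]
        exact norm_pos_iff.2 this
      · positivity)
  exact ⟨ε, hε, fun α hα Φ hΦ => h (α, Φ) ⟨hα, hΦ⟩⟩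

/-- For small `α` the energies are strictly decreasing along a sorted eigenbasis. -/
theorem eventually_energy_lt (n M : ℕ) :
    ∀ᶠ α in 𝓝[>] (0 : ℝ), ∀ Φ : Fin (n + 1) → Fin (n + 1) → ℂ,
      Unreduced n (offCoeff (n + 1) α) →
      IsFrame (prolateMat (n + 1) M α) Φ → ∀ i j : Fin (n + 1), i < j → (i : ℕ) < M →
        energy (n + 1) M α (Φ j) < energy (n + 1) M α (Φ i) := by
  choose ε hε hεb using exists_slopeMoment_lower_bound n M
  set ε₀ := univ.inf' univ_nonempty ε with hε₀
  have hε₀pos : 0 < ε₀ := by rw [hε₀, lt_inf'_iff]; exact fun i _ => hε i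
  have hε₀le : ∀ i, ε₀ ≤ ε i := fun i => inf'_le _ (mem_univ i)
  set C : ℝ := M * (2 ^ M * (2 * (n + 1 : ℕ) + 1) ^ M) ^ 2 * (n + 1 : ℕ) with hC
  have hC0 : 0 ≤ C := by positivity
  have ev1 : ∀ᶠ α in 𝓝[>] (0 : ℝ), α < min 1 (ε₀ / 2) :=
    nhdsWithin_le_nhds (gt_mem_nhds (by positivity))
  have ev2 : ∀ᶠ α in 𝓝[>] (0 : ℝ), C * 4 ^ M * α ^ 2 < (ε₀ / 2) ^ 2 := by
    have hc : Continuous fun α : ℝ => C * 4 ^ M * α ^ 2 := by fun_prop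
    have := hc.tendsto 0
    simp only [ne_eq, OfNat.ofNat_ne_zero, not_false_eq_true, zero_pow, mul_zero] at this
    exact nhdsWithin_le_nhds (this.eventually (gt_mem_nhds (by positivity)))
  filter_upwards [ev1, ev2, self_mem_nhdsWithin] with α h1 h2 h0 Φ hb hΦ i j hij hiM
  have hα : 0 < α := h0
  have hα1 : α ≤ 1 := (h1.trans_le (min_le_left _ _)).le
  have hα2 : α < ε₀ / 2 := h1.trans_le (min_le_right _ _)
  by_contra! hle
  -- Each `Φ a` with `a ≤ i` has energy at least of order `α ^ (2 * a)`, hence of order `α ^ (2 *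
  -- i)` since `α ≤ 1`. Under the assumed violation `Φ j` inherits the bound for `Φ i`.
  have low : ∀ a ≤ i, (ε₀ / 2 * α ^ (i : ℕ) / 2 ^ (i : ℕ)) ^ 2 ≤ energy (n + 1) M α (Φ a) := by
    intro a ha
    have ha' : (a : ℕ) ≤ i := ha
    have m1 := hεb a α ⟨hα.le, hα1⟩ Φ (hΦ.scaled hα)
    have m2 : ε₀ / 2 ≤ ‖slopeMoment M α (Φ a) a‖ := by linarith [hε₀le a]
    have m3 := slopeMoment_le hα (Φ a) (r := a) (M := M) (by omega)
    refine (Real.le_sqrt (by positivity) (energy_nonneg _ _ _ _)).1 ?_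
    rw [div_le_iff₀ (by positivity)]
    calc ε₀ / 2 * α ^ (i : ℕ) ≤ ‖slopeMoment M α (Φ a) a‖ * α ^ (a : ℕ) := by
          exact mul_le_mul m2 (pow_le_pow_of_le_one hα.le hα1 ha') (by positivity) (norm_nonneg _)
      _ ≤ 2 ^ (a : ℕ) * √(energy (n + 1) M α (Φ a)) := by rw [mul_comm]; exact m3
      _ ≤ √(energy (n + 1) M α (Φ a)) * 2 ^ (i : ℕ) := by
          rw [mul_comm]
          exact mul_le_mul_of_nonneg_left (pow_le_pow_right₀ one_le_two ha') (Real.sqrt_nonneg _)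
  obtain ⟨c, hc0, hcs, hc⟩ := exists_ne_zero_supported (p := i + 1) (insert j (Iic i))
    (by rw [card_insert_of_notMem (by simpa using hij), Fin.card_Iic]; omega)
    (fun r k => slopeMoment M α (Φ k) r)
  set ψ := ∑ k, c k • Φ k with hψ
  have up := energy_le_of_slopeMoment_eq_zero (M := M) hα hα1 (v := ψ) (k := i + 1) (by
    intro r hr
    rw [← hc ⟨r, hr⟩]
    simp only [slopeMoment, hψ, Finset.sum_apply, Pi.smul_apply, smul_eq_mul, sum_mul]
    rw [sum_comm]
    exact sum_congr rfl fun k _ => sum_congr rfl fun x _ => by ring)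
  rw [hψ, hΦ.ortho.norm_sum, hΦ.energy_sum hb, ← hC] at up
  have lo : (ε₀ / 2 * α ^ (i : ℕ) / 2 ^ (i : ℕ)) ^ 2 * ∑ k, ‖c k‖ ^ 2 ≤
      ∑ k, ‖c k‖ ^ 2 * energy (n + 1) M α (Φ k) := by
    rw [mul_sum]
    refine sum_le_sum fun k _ => ?_
    rw [mul_comm]
    by_cases hk : k ∈ insert j (Iic i)
    · refine mul_le_mul_of_nonneg_left ?_ (by positivity)
      rcases mem_insert.1 hk with rfl | hk
      · exact (low i le_rfl).trans hle
      · exact low k (mem_Iic.1 hk)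
    · simp [hcs k hk]
  have hpos : 0 < ∑ k, ‖c k‖ ^ 2 := by
    obtain ⟨k, hk⟩ := Function.ne_iff.1 hc0
    refine sum_pos' (fun _ _ => by positivity) ⟨k, mem_univ k, ?_⟩
    have : 0 < ‖c k‖ := norm_pos_iff.2 hk
    positivity
  have cmp := le_of_mul_le_mul_right (lo.trans up) hpos
  have e1 : (ε₀ / 2 * α ^ (i : ℕ) / 2 ^ (i : ℕ)) ^ 2 =
      (ε₀ / 2) ^ 2 * (α ^ (2 * (i : ℕ)) / 4 ^ (i : ℕ)) := by
    rw [div_pow, mul_pow, ← pow_mul, ← pow_mul, mul_comm (i : ℕ) 2, pow_mul 2 2,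
      show (2 : ℝ) ^ 2 = 4 by norm_num]
    ring
  rw [e1, mul_div_assoc', div_le_iff₀ (by positivity)] at cmp
  have e2 : C * α ^ (2 * ((i : ℕ) + 1)) * 4 ^ (i : ℕ) =
      C * 4 ^ (i : ℕ) * α ^ 2 * α ^ (2 * (i : ℕ)) := by ring
  rw [e2] at cmp
  have cmp2 := le_of_mul_le_mul_right cmp (by positivity)
  have : C * 4 ^ (i : ℕ) * α ^ 2 ≤ C * 4 ^ M * α ^ 2 := by
    have : (4 : ℝ) ^ (i : ℕ) ≤ 4 ^ M := pow_le_pow_right₀ (by norm_num) hiM.le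
    gcongr
  linarith

/-- Energies are strictly decreasing along a sorted eigenbasis as long as they are nonzero. -/
theorem IsFrame.energy_lt {n M : ℕ} {α₀ : ℝ} (hα₀ : 0 < α₀) (hN : (n : ℝ) * α₀ < Real.pi)
    (hM : ((M : ℝ) + n - 1) * α₀ < Real.pi) {Φ₀ : Fin (n + 1) → Fin (n + 1) → ℂ}
    (h₀ : IsFrame (prolateMat (n + 1) M α₀) Φ₀) {i j : Fin (n + 1)} (hij : i < j)
    (hi : (i : ℕ) < M) :
    energy (n + 1) M α₀ (Φ₀ j) < energy (n + 1) M α₀ (Φ₀ i) := by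
  have hM1 : (1 : ℝ) ≤ M := by exact_mod_cast (by omega : 1 ≤ M)
  have hn0 : (0 : ℝ) ≤ n := by positivity
  obtain ⟨α₁, hα₁, h0, h1⟩ := ((eventually_energy_lt n M).and
    (Ioo_mem_nhdsGT hα₀)).exists
  have hcond : ∀ α ∈ Set.Icc α₁ α₀, 0 < α ∧ (n : ℝ) * α < Real.pi ∧
      ((M : ℝ) + n - 1) * α < Real.pi := fun α hα =>
    ⟨h0.trans_le hα.1, (mul_le_mul_of_nonneg_left hα.2 hn0).trans_lt hN,
      (mul_le_mul_of_nonneg_left hα.2 (by linarith)).trans_lt hM⟩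
  by_contra! hbad
  let Z := {p : ℝ × (Fin (n + 1) → Fin (n + 1) → ℂ) |
    p.1 ∈ Set.Icc α₁ α₀ ∧ IsFrame (prolateMat (n + 1) M p.1) p.2}
  have hZ : IsCompact Z := isCompact_isFrame (continuous_prolateMat (n + 1) M) α₁ α₀
  -- `G` collects the weakly ordered bases and `B` those with a violation or a tie. The projections
  -- to `α` are closed, cover the interval and are both nonempty, so they meet.
  let G := {p : ℝ × (Fin (n + 1) → Fin (n + 1) → ℂ) | ∀ i j : Fin (n + 1), i < j → (i : ℕ) < M →
    energy (n + 1) M p.1 (p.2 j) ≤ energy (n + 1) M p.1 (p.2 i)}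
  let B := {p : ℝ × (Fin (n + 1) → Fin (n + 1) → ℂ) | ∃ i j : Fin (n + 1), i < j ∧ (i : ℕ) < M ∧
    energy (n + 1) M p.1 (p.2 i) ≤ energy (n + 1) M p.1 (p.2 j)}
  have hc := continuous_energy (n + 1) M
  have hG : IsClosed G := by
    simp only [G, Set.ofPred_forall]
    exact isClosed_iInter fun i => isClosed_iInter fun j => isClosed_iInter fun _ =>
      isClosed_iInter fun _ => isClosed_le (hc j) (hc i)
  have hB : IsClosed B := by
    have : B = ⋃ i : Fin (n + 1), ⋃ j : Fin (n + 1), {p | i < j ∧ (i : ℕ) < M ∧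
        energy (n + 1) M p.1 (p.2 i) ≤ energy (n + 1) M p.1 (p.2 j)} := by
      ext p; simp [B]
    rw [this]
    refine isClosed_iUnion_of_finite fun i => isClosed_iUnion_of_finite fun j => ?_
    exact (isClosed_const (p := i < j)).inter ((isClosed_const (p := (i : ℕ) < M)).inter
      (isClosed_le (hc i) (hc j)))
  have cG : IsClosed (Prod.fst '' (Z ∩ G)) :=
    ((hZ.inter_right hG).image continuous_fst).isClosed
  have cB : IsClosed (Prod.fst '' (Z ∩ B)) :=
    ((hZ.inter_right hB).image continuous_fst).isClosed
  have cover : Set.Icc α₁ α₀ ⊆ Prod.fst '' (Z ∩ G) ∪ Prod.fst '' (Z ∩ B) := by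
    intro α hα
    obtain ⟨Φ, hΦ⟩ := exists_isFrame (isHermitian_triMat (n + 1) (diagCoeff (n + 1) M α)
      (offCoeff (n + 1) α))
    by_cases hg : (α, Φ) ∈ G
    · exact Or.inl ⟨(α, Φ), ⟨⟨hα, hΦ⟩, hg⟩, rfl⟩
    · refine Or.inr ⟨(α, Φ), ⟨⟨hα, hΦ⟩, ?_⟩, rfl⟩
      simp only [G, Set.mem_ofPred_eq, not_forall, not_le] at hg
      obtain ⟨i, j, h1, h2, h3⟩ := hg
      exact ⟨i, j, h1, h2, h3.le⟩
  have l : α₁ ≤ α₀ := h1.le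
  have neG : (Set.Icc α₁ α₀ ∩ Prod.fst '' (Z ∩ G)).Nonempty := by
    obtain ⟨Φ, hΦ⟩ := exists_isFrame (isHermitian_triMat (n + 1) (diagCoeff (n + 1) M α₁)
      (offCoeff (n + 1) α₁))
    have m : α₁ ∈ Set.Icc α₁ α₀ := ⟨le_rfl, l⟩
    exact ⟨α₁, m, (α₁, Φ), ⟨⟨m, hΦ⟩, fun i j h1 h2 =>
      (hα₁ Φ (unreduced_offCoeff h0 (hcond α₁ m).2.1) hΦ i j h1 h2).le⟩, rfl⟩
  have neB : (Set.Icc α₁ α₀ ∩ Prod.fst '' (Z ∩ B)).Nonempty :=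
    ⟨α₀, ⟨l, le_rfl⟩, (α₀, Φ₀), ⟨⟨⟨l, le_rfl⟩, h₀⟩, i, j, hij, hi, hbad⟩, rfl⟩
  obtain ⟨α, hα, ⟨⟨α', Φ⟩, ⟨⟨_, hΦ⟩, hΦG⟩, rfl⟩, ⟨⟨α', Ψ⟩, ⟨⟨_, hΨ⟩, k, l, hkl, hk, hle⟩, rfl⟩⟩ :=
    isPreconnected_closed_iff.1 isPreconnected_Icc _ _ cG cB cover neG neB
  obtain ⟨p0, p1, p2⟩ := hcond _ hα
  simp only at hΦ hΨ hle p0 p1 p2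
  have hb := unreduced_offCoeff p0 p1
  -- Both bases over the common `α` have the same energies, so a tie occurs. A tie forces energy
  -- zero at `k < M`, and weak order then makes all later energies zero.
  rw [hΨ.energy_unique hb hΦ, hΨ.energy_unique hb hΦ] at hle
  have heq := le_antisymm hle (hΦG k l hkl hk)
  have hz := hΦ.energy_eq_zero_of_eq p0 p1 p2 hkl.ne heq
  obtain ⟨q, hkq, hq⟩ := hΦ.exists_energy_ne_zero p0 p1 hk
  rcases hkq.eq_or_lt with rfl | hkq
  · exact hq hz
  · have := hΦG k q hkq hk
    simp only [hz] at this
    exact hq (le_antisymm this (energy_nonneg _ _ _ _))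

/-- Among index `j` and the `M` indices below `M`, some energy vanishes. If it is not the one at
`j`, strict decrease would make the energy at `j` negative. -/
theorem IsFrame.energy_eq_zero {n M : ℕ} {α : ℝ} (hα : 0 < α) (hN : (n : ℝ) * α < Real.pi)
    (hM : ((M : ℝ) + n - 1) * α < Real.pi) {Φ : Fin (n + 1) → Fin (n + 1) → ℂ}
    (h : IsFrame (prolateMat (n + 1) M α) Φ) {j : Fin (n + 1)} (hj : M ≤ (j : ℕ)) :
    energy (n + 1) M α (Φ j) = 0 := by
  by_contra hne
  have hpos : 0 < energy (n + 1) M α (Φ j) := lt_of_le_of_ne (energy_nonneg _ _ _ _) (Ne.symm hne)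
  let m : Fin (n + 1) := ⟨M, by omega⟩
  obtain ⟨i, hi, hi0⟩ := h.exists_energy_eq_zero hα hN (insert j (Iio m)) (by
    rw [card_insert_of_notMem (by simpa [m, Fin.lt_def] using hj), Fin.card_Iio]
    exact Nat.lt_succ_self M)
  rcases mem_insert.1 hi with rfl | hi
  · exact hne hi0
  · have hi' : (i : ℕ) < M := Fin.lt_def.1 (mem_Iio.1 hi)
    have := h.energy_lt hα hN hM (Fin.lt_def.2 (by omega)) hi' (j := j)
    linarith

end PeriodicProlate

/-! ### Sorted eigenvalues and complementary frequencies -/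

namespace PeriodicProlate

open Finset Matrix

/-- The sorted eigenvalues of a symmetric operator can be read off any sorted orthonormal
eigenbasis. -/
theorem eigenvalues_eq_of_orthonormalBasis {E : Type*} [NormedAddCommGroup E]
    [InnerProductSpace ℂ E] [FiniteDimensional ℂ E] {N : ℕ} {A : E →ₗ[ℂ] E} (hA : A.IsSymmetric)
    (hn : Module.finrank ℂ E = N) (φ : OrthonormalBasis (Fin N) ℂ E) {s : Fin N → ℝ}
    (hs : Antitone s) (h : ∀ i, A (φ i) = (s i : ℂ) • φ i) : hA.eigenvalues hn = s := by
  -- In the eigenbasis the operator is diagonal, so the roots of its characteristic polynomial give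
  -- `s` as a multiset; two sorted lists with the same multiset coincide.
  have hm : LinearMap.toMatrix φ.toBasis φ.toBasis A = diagonal fun i => (s i : ℂ) := by
    ext i j
    rw [LinearMap.toMatrix_apply, OrthonormalBasis.coe_toBasis, h j, map_smul,
      ← OrthonormalBasis.coe_toBasis, Module.Basis.repr_self, Finsupp.smul_apply,
      Finsupp.single_apply, diagonal_apply]
    by_cases hij : i = j
    · simp [hij]
    · simp [hij, Ne.symm hij]
  have hr : A.charpoly.roots = Multiset.map (fun i => (s i : ℂ)) Finset.univ.val := by
    rw [← LinearMap.charpoly_toMatrix _ φ.toBasis, hm, Matrix.charpoly_diagonal,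
      Polynomial.roots_prod _ _ (by
        simp [Finset.prod_ne_zero_iff, Polynomial.X_sub_C_ne_zero])]
    simp
  have h2 := congrArg (Multiset.map Complex.re)
    ((hA.roots_charpoly_eq_eigenvalues hn).symm.trans hr)
  rw [Multiset.map_map, Multiset.map_map] at h2
  have h3 : Multiset.map (hA.eigenvalues hn) Finset.univ.val = Multiset.map s Finset.univ.val := by
    convert h2 using 1 <;> rfl
  rw [Fin.univ_val_map, Fin.univ_val_map, Multiset.coe_eq_coe] at h3
  exact List.ofFn_injective (h3.eq_of_sortedGE (hA.eigenvalues_antitone hn).sortedGE_ofFn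
    hs.sortedGE_ofFn)

/-- Multiplication by alternating signs. -/
noncomputable def alternate {N : ℕ} (v : Fin N → ℂ) : Fin N → ℂ := fun i => (-1) ^ (i : ℕ) * v i

theorem star_alternate_dotProduct {N : ℕ} (u v : Fin N → ℂ) :
    star (alternate u) ⬝ᵥ alternate v = star u ⬝ᵥ v := by
  refine sum_congr rfl fun i _ => ?_
  simp only [alternate, Pi.star_apply, star_mul', star_pow, star_neg, star_one]
  rw [show (-1 : ℂ) ^ (i : ℕ) * star (u i) * ((-1) ^ (i : ℕ) * v i) =
    ((-1) ^ (i : ℕ) * (-1) ^ (i : ℕ)) * (star (u i) * v i) by ring, ← mul_pow]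
  simp

theorem mulVec_alternate {N : ℕ} {S S' : Matrix (Fin N) (Fin N) ℂ} {a b : ℂ}
    (h : ∀ i j, S' i j = a * (1 : Matrix (Fin N) (Fin N) ℂ) i j +
      b * ((-1) ^ (i : ℕ) * (-1) ^ (j : ℕ) * S i j))
    (v : Fin N → ℂ) : S' *ᵥ alternate v = a • alternate v + b • alternate (S *ᵥ v) := by
  ext i
  have h1 : (a • alternate v) i = ∑ j, a * (1 : Matrix (Fin N) (Fin N) ℂ) i j * alternate v j := by
    simp [Matrix.one_apply]
  rw [Pi.add_apply, h1, Pi.smul_apply, alternate, mulVec, mulVec, dotProduct, dotProduct,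
    smul_eq_mul, mul_sum, mul_sum, ← sum_add_distrib]
  refine sum_congr rfl fun j _ => ?_
  have : (-1 : ℂ) ^ (j : ℕ) * (-1) ^ (j : ℕ) = 1 := by rw [← mul_pow]; simp
  rw [h, alternate]
  linear_combination b * (-1) ^ (i : ℕ) * S i j * v j * this

theorem dirichletKer_zero (M : ℕ) (α : ℝ) : dirichletKer M α 0 = M := by
  simp [dirichletKer]

theorem sin_int_mul_pi_sub (d : ℤ) (y : ℝ) :
    Real.sin (d * Real.pi - y) = -((-1) ^ d * Real.sin y) := by
  rw [Real.sin_int_mul_pi_sub]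

/-- Complementary sets of frequencies have complementary Dirichlet kernels. -/
theorem dirichletKer_complement {M M' : ℕ} {α : ℝ} (hα : α * (M + M') = Real.pi) (hα0 : 0 < α)
    {d : ℤ} (hd : d ≠ 0) (hd1 : |(d : ℝ)| * α < Real.pi) :
    dirichletKer M' α d = -((-1) ^ d * dirichletKer M α d) := by
  have s1 := sin_mul_dirichletKer M α d
  have s2 := sin_mul_dirichletKer M' α d
  have e : Real.sin (α * M' * d) = -((-1) ^ d * Real.sin (α * M * d)) := by
    rw [← sin_int_mul_pi_sub, ← hα]; ring_nf
  have e' : (Real.sin (α * M' * d) : ℂ) = -((-1) ^ d * (Real.sin (α * M * d) : ℂ)) := by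
    rw [e]; push_cast; rfl
  have hs : Real.sin (α * d) ≠ 0 := by
    rcases lt_or_gt_of_ne hd with h | h
    · have h' : (d : ℝ) < 0 := by exact_mod_cast h
      rw [abs_of_neg h'] at hd1
      exact (Real.sin_neg_of_neg_of_neg_pi_lt (by nlinarith) (by nlinarith)).ne
    · have h' : (0 : ℝ) < d := by exact_mod_cast h
      rw [abs_of_pos h'] at hd1
      exact (Real.sin_pos_of_pos_of_lt_pi (by positivity) (by nlinarith)).ne'
  refine mul_left_cancel₀ (Complex.ofReal_ne_zero.2 hs) ?_
  rw [s2, e', ← s1]; ring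

theorem neg_one_pow_mul (i j : ℕ) : (-1 : ℂ) ^ i * (-1) ^ j = (-1) ^ ((i : ℤ) - j) := by
  rw [zpow_sub₀ (by simp), zpow_natCast, zpow_natCast, div_eq_mul_inv, ← inv_pow]
  norm_num

theorem kerMat_complement {N M M' : ℕ} {α : ℝ} (hα : α * (M + M') = Real.pi) (hα0 : 0 < α)
    (hN : N ≤ M + M') (i j : Fin N) :
    kerMat N M' α i j = ((M + M' : ℕ) : ℂ) * (1 : Matrix (Fin N) (Fin N) ℂ) i j +
      (-1) * ((-1) ^ (i : ℕ) * (-1) ^ (j : ℕ) * kerMat N M α i j) := by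
  by_cases h : i = j
  · subst h
    rw [neg_one_pow_mul]
    simp only [kerMat, of_apply, sub_self, dirichletKer_zero, Matrix.one_apply_eq, zpow_zero]
    push_cast; ring
  · have hd : ((i : ℕ) : ℤ) - (j : ℕ) ≠ 0 := by
      intro e; apply h; ext; omega
    rw [neg_one_pow_mul, Matrix.one_apply_ne h, mul_zero, zero_add]
    simp only [kerMat, of_apply]
    rw [dirichletKer_complement hα hα0 hd]
    · ring
    · rw [← hα, mul_comm]
      refine mul_lt_mul_of_pos_left ?_ hα0
      have : |((i : ℕ) : ℤ) - (j : ℕ)| < ((M + M' : ℕ) : ℤ) := by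
        rw [abs_lt]; omega
      exact_mod_cast this

/-- Replacing `αM` by `π - αM` negates the diagonal. The off-diagonal does not depend on `M`, and
its sign comes from neighbouring alternating signs. -/
theorem prolateMat_complement {N M M' : ℕ} {α : ℝ} (hα : α * (M + M') = Real.pi) (i j : Fin N) :
    prolateMat N M' α i j = 0 * (1 : Matrix (Fin N) (Fin N) ℂ) i j +
      (-1) * ((-1) ^ (i : ℕ) * (-1) ^ (j : ℕ) * prolateMat N M α i j) := by
  have hc : ∀ x, diagCoeff N M' α x = -diagCoeff N M α x := by
    intro x
    rw [diagCoeff, diagCoeff, show α * M' = Real.pi - α * M by rw [← hα]; ring, Real.cos_pi_sub]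
    ring
  have sq (k : ℕ) : (-1 : ℂ) ^ k * (-1) ^ k = 1 := by rw [← mul_pow]; simp
  simp only [prolateMat, triMat, of_apply, zero_mul, zero_add]
  split_ifs with h1 h2 h3
  · rw [← h1, sq, hc]; push_cast; ring
  · rw [← h2, pow_succ]
    linear_combination (-(offCoeff N α ((((i : ℕ) + 1 : ℕ) : ℤ)) : ℂ)) * sq i
  · rw [← h3, pow_succ]
    linear_combination (-(offCoeff N α ((((j : ℕ) + 1 : ℕ) : ℤ)) : ℂ)) * sq j
  · simp

/-- Passing to the complementary frequencies reverses the order of a sorted eigenbasis. -/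
theorem IsFrame.complement {N M M' : ℕ} {α : ℝ} (hα : α * (M + M') = Real.pi)
    {Ψ : Fin N → Fin N → ℂ} (h : IsFrame (prolateMat N M α) Ψ) :
    IsFrame (prolateMat N M' α) fun i => alternate (Ψ (Fin.rev i)) := by
  have ho : IsOrtho fun i => alternate (Ψ (Fin.rev i)) := by
    intro i j
    rw [star_alternate_dotProduct, h.ortho]
    simp [Fin.rev_inj]
  have he : ∀ i, prolateMat N M' α *ᵥ alternate (Ψ (Fin.rev i)) =
      ((-ray (prolateMat N M α) (Ψ (Fin.rev i)) : ℝ) : ℂ) • alternate (Ψ (Fin.rev i)) := by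
    intro i
    rw [mulVec_alternate (prolateMat_complement hα), h.eigen]
    ext x
    simp only [alternate, Pi.add_apply, Pi.smul_apply, smul_eq_mul, Complex.ofReal_neg]
    ring
  have hr := fun i => ho.ray_eq (he i)
  refine ⟨ho, fun i => by rw [hr i, he i], fun i j hij => ?_⟩
  simp only [hr]
  exact neg_le_neg (h.anti (Fin.rev_le_rev.2 hij))

end PeriodicProlate

/-! ### The Fourier extension matrix and the main theorem -/

namespace PeriodicProlate

open Finset Matrix

variable {n m : ℕ} {T : ℝ} {L : ℕ}

/-- Centring the columns multiplies them by phases that depend only on the row, and these cancel in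
the Gram matrix. -/
theorem gram_feMatrix (hL : (L : ℝ) = 2 * T * m) (hL0 : 0 < L) :
    (feMatrix n m T)ᴴ * feMatrix n m T =
      ((1 / L : ℝ) : ℂ) • kerMat (2 * n + 1) (2 * m + 1) (Real.pi / L) := by
  have hL0' : (0 : ℝ) < L := by exact_mod_cast hL0
  ext i j
  rw [← trigMat_conjTranspose_mul, Matrix.smul_apply, mul_apply, mul_apply, smul_eq_mul, mul_sum]
  refine sum_congr rfl fun l _ => ?_
  simp only [conjTranspose_apply, feMatrix, trigMat, of_apply, star_mul', Complex.star_def,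
    Complex.conj_ofReal, ← Complex.exp_conj, map_mul, Complex.conj_I]
  have ha : ((1 / √(2 * T * m) : ℝ) : ℂ) * ((1 / √(2 * T * m) : ℝ) : ℂ) = ((1 / L : ℝ) : ℂ) := by
    rw [← hL, ← Complex.ofReal_mul, div_mul_div_comm, Real.mul_self_sqrt hL0'.le, one_mul]
  rw [mul_mul_mul_comm, ha, ← Complex.exp_add, ← Complex.exp_add]
  congr 2
  have hTm : T * m = L / 2 := by rw [hL]; ring
  have e : Real.pi * (((j : ℕ) : ℝ) - n) * (((l : ℕ) : ℝ) - m) / (T * m) -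
      Real.pi * (((i : ℕ) : ℝ) - n) * (((l : ℕ) : ℝ) - m) / (T * m) =
      freq (2 * m + 1) (Real.pi / L) l * (j : ℕ) - freq (2 * m + 1) (Real.pi / L) l * (i : ℕ) := by
    rw [hTm, freq]
    push_cast
    field_simp
    ring
  have e' := congrArg (fun x : ℝ => (x : ℂ)) e
  simp only [Complex.ofReal_sub] at e'
  linear_combination Complex.I * e'

theorem feJacobi_eq_prolateMat (hL : (L : ℝ) = 2 * T * m) :
    feJacobi n m T = prolateMat (2 * n + 1) (2 * m + 1) (Real.pi / L) := by
  ext i j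
  simp only [feJacobi, map_apply, jacobiMatrix, prolateMat, triMat, of_apply, ← hL]
  have hc (k : ℕ) : jacobiDiag (2 * n + 1) (2 * m + 1) L k =
      diagCoeff (2 * n + 1) (2 * m + 1) (Real.pi / L) k := by
    rw [jacobiDiag, diagCoeff]; push_cast; ring_nf
  have hb (k : ℕ) : jacobiOff (2 * n + 1) L k = offCoeff (2 * n + 1) (Real.pi / L) k := by
    rw [jacobiOff, offCoeff]; push_cast; ring_nf
  rw [hc, hb, hb]

/-- The sorted eigenvalues of `T_{N,M}` come with a sorted orthonormal eigenbasis. -/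
theorem exists_isFrame_feTheta (n m : ℕ) (T : ℝ) :
    ∃ Ψ, IsFrame (feJacobi n m T) Ψ ∧ ∀ i, ray (feJacobi n m T) (Ψ i) = feTheta n m T i := by
  let J := jacobiMatrix (2 * n + 1) (2 * m + 1) (2 * T * m)
  have hJ : J.IsHermitian := jacobiMatrix_isHermitian _ _ _
  have hsym := isSymmetric_toEuclideanLin_iff.mpr hJ
  let φ := hsym.eigenvectorBasis finrank_euclideanSpace
  let κ := Fin.cast (Fintype.card_fin (2 * n + 1)).symm
  have he (i : Fin (2 * n + 1)) : J *ᵥ (φ (κ i)).ofLp = feTheta n m T i • (φ (κ i)).ofLp :=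
    congrArg WithLp.ofLp (hsym.apply_eigenvectorBasis finrank_euclideanSpace (κ i))
  let Ψ : Fin (2 * n + 1) → Fin (2 * n + 1) → ℂ := fun i x => ((φ (κ i)).ofLp x : ℂ)
  have hκ : Function.Injective κ := Fin.cast_injective _
  have ho : IsOrtho Ψ := by
    intro i j
    have h1 := (orthonormal_iff_ite.1 φ.orthonormal) (κ i) (κ j)
    rw [EuclideanSpace.inner_eq_star_dotProduct, dotProduct_comm] at h1
    have h2 := congrArg (fun x : ℝ => (x : ℂ)) h1
    simp only [dotProduct, Pi.star_apply, star_trivial, Complex.ofReal_sum,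
      Complex.ofReal_mul] at h2
    simp only [dotProduct, Ψ, Pi.star_apply, Complex.star_def, Complex.conj_ofReal]
    rw [h2]
    simp only [hκ.eq_iff]
    split_ifs <;> simp
  have heC (i : Fin (2 * n + 1)) : feJacobi n m T *ᵥ Ψ i = (feTheta n m T i : ℂ) • Ψ i := by
    ext x
    have h2 := congrArg (fun x : ℝ => (x : ℂ)) (congrFun (he i) x)
    simp only [mulVec, dotProduct, Complex.ofReal_sum, Complex.ofReal_mul, Pi.smul_apply,
      smul_eq_mul] at h2
    simp only [mulVec, dotProduct, Pi.smul_apply, smul_eq_mul, feJacobi, map_apply, Ψ]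
    exact h2
  have hr := fun i => ho.ray_eq (heC i)
  refine ⟨Ψ, ⟨ho, fun i => by rw [hr i, heC i], fun i j hij => ?_⟩, hr⟩
  simp only [hr]
  exact (jacobiMatrix_isHermitian (2 * n + 1) (2 * m + 1) (2 * T * m)).eigenvalues₀_antitone
    (by simpa using hij)

theorem sq_feSingularValue {φ : OrthonormalBasis (Fin (2 * n + 1)) ℂ
      (EuclideanSpace ℂ (Fin (2 * n + 1)))} {s : Fin (2 * n + 1) → ℝ} (hs : Antitone s)
    (h : ∀ i, toEuclideanLin ((feMatrix n m T)ᴴ * feMatrix n m T) (φ i) = (s i : ℂ) • φ i)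
    (i : Fin (2 * n + 1)) : feSingularValue n m T i ^ 2 = s i := by
  have hn : Module.finrank ℂ (EuclideanSpace ℂ (Fin (2 * n + 1))) = 2 * n + 1 := by simp
  rw [feSingularValue, LinearMap.sq_singularValues_fin _ hn,
    eigenvalues_eq_of_orthonormalBasis _ hn φ hs]
  intro i
  rw [← h i, LinearMap.comp_apply, ← toEuclideanLin_conjTranspose_eq_adjoint]
  simp only [toLpLin_apply, mulVec_mulVec]

theorem feSingularValue_nonneg (n m : ℕ) (T : ℝ) (i : Fin (2 * n + 1)) :
    0 ≤ feSingularValue n m T i := LinearMap.singularValues_nonneg _ _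

theorem feSingularValue_antitone (n m : ℕ) (T : ℝ) : Antitone (feSingularValue n m T) :=
  fun _ _ hij => LinearMap.singularValues_antitone _ hij

/-- An orthonormal family in matrix form as an orthonormal basis of Euclidean space. -/
theorem IsOrtho.exists_orthonormalBasis {N : ℕ} {Φ : Fin N → Fin N → ℂ} (h : IsOrtho Φ) :
    ∃ φ : OrthonormalBasis (Fin N) ℂ (EuclideanSpace ℂ (Fin N)),
      ∀ i, φ i = WithLp.toLp 2 (Φ i) := by
  have ho : Orthonormal ℂ fun i => (WithLp.toLp 2 (Φ i) : EuclideanSpace ℂ (Fin N)) := by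
    rw [orthonormal_iff_ite]
    intro i j
    rw [EuclideanSpace.inner_eq_star_dotProduct, dotProduct_comm]
    exact h i j
  refine ⟨OrthonormalBasis.mk ho (ho.linearIndependent.span_eq_top_of_card_eq_finrank' (by
    simp)).ge, fun i => by simp⟩

theorem toEuclideanLin_eigen_iff {N : ℕ} {S : Matrix (Fin N) (Fin N) ℂ}
    {v : EuclideanSpace ℂ (Fin N)} {κ : ℂ} :
    toEuclideanLin S v = κ • v ↔ S *ᵥ v.ofLp = κ • v.ofLp := by
  constructor
  · intro h; exact congrArg WithLp.ofLp h
  · intro h; exact congrArg (WithLp.toLp 2) h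

end PeriodicProlate

open PeriodicProlate in
theorem theorem1 (n m : ℕ) (hm : 1 ≤ m) (hnm : 2 * n + 1 ≤ 2 * m + 1)
    (T : ℝ) (hT : 1 < T) (L : ℕ) (hL : (L : ℝ) = 2 * T * m) :
    ((feMatrix n m T).conjTranspose * feMatrix n m T).IsSymm ∧
    Commute ((feMatrix n m T).conjTranspose * feMatrix n m T) (feJacobi n m T) ∧
    StrictAnti (feTheta n m T) ∧
    (∀ i₁ i₂ : Fin (2 * n + 1), i₁ < i₂ →
      (feSingularValue n m T i₁ = feSingularValue n m T i₂ ↔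
        L + (i₂ : ℕ) < (2 * m + 1) + (2 * n + 1))) ∧
    IsIndexMap n m T id ∧
    (∀ g : Fin (2 * n + 1) → Fin (2 * n + 1), IsIndexMap n m T g →
      ∀ i₁ i₂ : Fin (2 * n + 1), feSingularValue n m T i₁ ≠ feSingularValue n m T i₂ →
        (i₁ > i₂ ↔ g i₁ > g i₂)) ∧
    ((2 * m + 1) + (2 * n + 1) ≤ L + 1 →
      ∀ g : Fin (2 * n + 1) → Fin (2 * n + 1), IsIndexMap n m T g →
        (∀ i₁ i₂ : Fin (2 * n + 1), i₁ > i₂ ↔ g i₁ > g i₂) ∧ g = id) := by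
  have hmR : (1 : ℝ) ≤ m := by exact_mod_cast hm
  have hLm : 2 * m + 1 ≤ L := by
    have : ((2 * m : ℕ) : ℝ) < L := by rw [hL]; push_cast; nlinarith
    have : 2 * m < L := by exact_mod_cast this
    omega
  obtain ⟨M', hM'⟩ : ∃ M', L = 2 * m + 1 + M' := ⟨L - (2 * m + 1), by omega⟩
  have hL0 : (0 : ℝ) < L := by exact_mod_cast (by omega : 0 < L)
  set α : ℝ := Real.pi / L with hα
  have hα0 : 0 < α := div_pos Real.pi_pos hL0
  have hαL : α * (((2 * m + 1 : ℕ) : ℝ) + (M' : ℝ)) = Real.pi := by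
    rw [hα, show ((2 * m + 1 : ℕ) : ℝ) + (M' : ℝ) = (L : ℝ) by rw [hM']; push_cast; ring]
    field_simp
  have hlt : ∀ x : ℝ, x < L → x * α < Real.pi := by
    intro x hx
    have : (L : ℝ) * α = Real.pi := by rw [hα]; field_simp
    rw [← this]
    exact mul_lt_mul_of_pos_right hx hα0
  have hN : ((2 * n : ℕ) : ℝ) * α < Real.pi := hlt _ (by exact_mod_cast (by omega : 2 * n < L))
  -- Here `N ≤ M` enters: it gives `M' + N - 2 < L` for the complementary count.
  have hMN : ((M' : ℝ) + ((2 * n : ℕ) : ℝ) - 1) * α < Real.pi := by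
    refine hlt _ ?_
    have : ((M' + 2 * n : ℕ) : ℝ) < ((L + 1 : ℕ) : ℝ) := by exact_mod_cast (by omega)
    push_cast at this ⊢
    linarith
  have hb : Unreduced (2 * n) (offCoeff (2 * n + 1) α) := unreduced_offCoeff hα0 hN
  have hgram := gram_feMatrix (n := n) hL (by omega)
  have hjac := feJacobi_eq_prolateMat (n := n) hL
  rw [← hα] at hgram hjac
  obtain ⟨Ψ, hΨ, hθ⟩ := exists_isFrame_feTheta n m T
  have hΨ' := hΨ
  rw [hjac] at hΨ'
  have hΦ := hΨ'.complement hαL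
  set E : Fin (2 * n + 1) → ℝ := fun i =>
    energy (2 * n + 1) M' α (alternate (Ψ (Fin.rev i))) with hE
  have E0 : ∀ i : Fin (2 * n + 1), M' ≤ (i : ℕ) → E i = 0 := fun i hi => hΦ.energy_eq_zero hα0 hN hMN hi
  have Elt : ∀ i j : Fin (2 * n + 1), i < j → (i : ℕ) < M' → E j < E i := fun i j hij hi =>
    hΦ.energy_lt hα0 hN hMN hij hi
  -- The eigenvalue of `AᴴA` at `Ψ i`: the kernel matrix is `L` minus the complementary one up to
  -- signs, and the basis is reversed.
  set s : Fin (2 * n + 1) → ℝ := fun i => (L - E (Fin.rev i)) / L with hs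
  have hsanti : Antitone s := by
    intro i j hij
    rcases hij.eq_or_lt with rfl | hij
    · exact le_rfl
    · have hrev := Fin.rev_lt_rev.2 hij
      have : E (Fin.rev i) ≤ E (Fin.rev j) := by
        rcases lt_or_ge ((Fin.rev j : Fin (2 * n + 1)) : ℕ) M' with h | h
        · exact (Elt _ _ hrev h).le
        · rw [E0 _ h, E0 _ (h.trans (Fin.lt_def.1 hrev).le)]
      simp only [hs]
      gcongr
  have hK : ∀ i, ((feMatrix n m T).conjTranspose * feMatrix n m T).mulVec (Ψ i) =
      (s i : ℂ) • Ψ i := by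
    intro i
    have h1 := hΦ.kerMat_eigen hb (Fin.rev i)
    rw [mulVec_alternate (kerMat_complement hαL hα0 (by omega)), ← hM', Fin.rev_rev] at h1
    have hEi : energy (2 * n + 1) M' α (alternate (Ψ i)) = E (Fin.rev i) := by
      simp only [hE, Fin.rev_rev]
    rw [hEi] at h1
    ext x
    have h2 := congrFun h1 x
    simp only [alternate, Pi.add_apply, Pi.smul_apply, smul_eq_mul] at h2
    have h3 : ((-1 : ℂ) ^ (x : ℕ)) ≠ 0 := pow_ne_zero _ (by simp)
    have h4 : (kerMat (2 * n + 1) (2 * m + 1) α).mulVec (Ψ i) x =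
        ((L : ℂ) - E (Fin.rev i)) * Ψ i x :=
      mul_left_cancel₀ h3 (by linear_combination -h2)
    have hL0' : (L : ℂ) ≠ 0 := by exact_mod_cast hL0.ne'
    rw [hgram, Matrix.smul_mulVec, Pi.smul_apply, Pi.smul_apply, smul_eq_mul, smul_eq_mul, h4]
    simp only [hs]
    push_cast
    field_simp
  obtain ⟨φ, hφ⟩ := hΨ.ortho.exists_orthonormalBasis
  have hKφ : ∀ i, Matrix.toEuclideanLin ((feMatrix n m T).conjTranspose * feMatrix n m T) (φ i) =
      (s i : ℂ) • φ i := by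
    intro i
    rw [toEuclideanLin_eigen_iff, hφ]
    exact hK i
  have hσ : ∀ i, feSingularValue n m T i ^ 2 = s i := sq_feSingularValue hsanti hKφ
  have hσeq : ∀ i j, feSingularValue n m T i = feSingularValue n m T j ↔ s i = s j := by
    intro i j
    rw [← hσ, ← hσ, sq_eq_sq₀ (feSingularValue_nonneg n m T i) (feSingularValue_nonneg n m T j)]
  have hseq : ∀ i j, s i = s j ↔ E (Fin.rev i) = E (Fin.rev j) := by
    intro i j
    simp only [hs]
    rw [div_left_inj' hL0.ne', sub_right_inj]
  have item2 : ∀ i₁ i₂ : Fin (2 * n + 1), i₁ < i₂ →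
      (feSingularValue n m T i₁ = feSingularValue n m T i₂ ↔
        L + (i₂ : ℕ) < (2 * m + 1) + (2 * n + 1)) := by
    intro i₁ i₂ h12
    rw [hσeq, hseq]
    have hrev := Fin.rev_lt_rev.2 h12
    have hval : ((Fin.rev i₂ : Fin (2 * n + 1)) : ℕ) = 2 * n - i₂ := by
      rw [Fin.val_rev]; omega
    have hi₂ := i₂.2
    -- The reversed index of `i₂` is the smaller one. Below `M'` the energies differ strictly; from
    -- `M'` on both are zero, which means `N - 1 - i₂ ≥ L - M`.
    rcases lt_or_ge ((Fin.rev i₂ : Fin (2 * n + 1)) : ℕ) M' with h | h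
    · refine iff_of_false (Elt _ _ hrev h).ne (by omega)
    · refine iff_of_true ?_ (by omega)
      rw [E0 _ h, E0 _ (h.trans (Fin.lt_def.1 hrev).le)]
  have hindex : ∀ g, IsIndexMap n m T g →
      ∀ i, feSingularValue n m T (g i) = feSingularValue n m T i := by
    rintro g ⟨χ, hχ⟩ i
    obtain ⟨h1, h2⟩ := hχ i
    rw [toEuclideanLin_eigen_iff] at h1 h2
    have h3 := hΨ.eigen (g i)
    rw [hθ] at h3
    rw [hjac] at h2 h3
    -- The basis vector `χ i` has the same simple eigenvalue as `Ψ (g i)`, hence is proportional to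
    -- it and shares its eigenvalue under `AᴴA`.
    have h4 := eigen_transfer hb h3 h2 (hΨ.ortho.ne_zero _) (hK (g i))
    have ho : IsOrtho fun i => (χ i).ofLp := IsOrtho.of_orthonormal χ.orthonormal
    have h5 := (ho.ray_eq h1).symm.trans (ho.ray_eq h4)
    rw [hσeq, ← h5, hσ]
  have item3 : ∀ g : Fin (2 * n + 1) → Fin (2 * n + 1), IsIndexMap n m T g →
      ∀ i₁ i₂ : Fin (2 * n + 1), feSingularValue n m T i₁ ≠ feSingularValue n m T i₂ →
        (i₁ > i₂ ↔ g i₁ > g i₂) := by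
    intro g hg i₁ i₂ hne
    have key : ∀ j₁ j₂, feSingularValue n m T j₁ ≠ feSingularValue n m T j₂ →
        (j₁ > j₂ ↔ feSingularValue n m T j₁ < feSingularValue n m T j₂) := by
      intro j₁ j₂ hne
      constructor
      · intro h
        exact lt_of_le_of_ne (feSingularValue_antitone n m T h.le) hne
      · intro h
        by_contra hle
        exact absurd (feSingularValue_antitone n m T (not_lt.1 hle)) (not_le.2 h)
    rw [key i₁ i₂ hne, ← hindex g hg i₁, ← hindex g hg i₂,
      key (g i₁) (g i₂) (by rwa [hindex g hg i₁, hindex g hg i₂])]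
  refine ⟨?_, ?_, ?_, item2, ⟨φ, fun i => ⟨?_, ?_⟩⟩, item3, ?_⟩
  · rw [hgram]
    ext i j
    simp only [Matrix.transpose_apply, Matrix.smul_apply, kerMat, Matrix.of_apply]
    rw [← dirichletKer_neg, neg_sub]
  · rw [hgram, hjac]
    exact (prolateMat_commute _ _ _).smul_left _
  · have hanti := hΨ'.strictAnti hb
    intro i j hij
    have h := hanti hij
    rw [← hθ, ← hθ, hjac]
    exact h
  · rw [hKφ, hσ]
  · rw [toEuclideanLin_eigen_iff, hφ]
    have := hΨ.eigen i
    rwa [hθ] at this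
  · intro hLMN g hg
    have hinj : Function.Injective (feSingularValue n m T) := by
      intro i j hij
      by_contra hne
      rcases lt_or_gt_of_ne hne with h | h
      · have := (item2 i j h).1 hij
        have := j.2
        have := Fin.lt_def.1 h
        omega
      · have := (item2 j i h).1 hij.symm
        have := Fin.lt_def.1 h
        have := i.2
        omega
    have hid : g = id := funext fun i => hinj (hindex g hg i)
    exact ⟨fun i₁ i₂ => by rw [hid]; rfl, hid⟩
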